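/- Let $m\ge 1$ and let $\Omega_{1,1},\dots,\Omega_{1,m},\Omega_{2,1},\dots,\Omega_{2,m}\subset\mathbb C$ be pairwise disjoint sets which are either all finite unions of (oriented, piecewise $C^1$) contours, with $d\mu=dz$, or all discrete sets, with $\mu$ the counting measure. Put $\Omega_\ell=\bigcup_j\Omega_{\ell,j}$ and $\Omega=\Omega_1\cup\Omega_2$; $L^2(\Omega,d\mu)$ is the $L^2$ space of arc length, respectively counting measure, and integral operators on it are taken against $d\mu$. Let $A_j,B_j,\mathsf m_j$ ($1\le j\le m$) and $c$ be measurable complex functions on $\Omega$, with all $\mathsf m_j$ and $c$ non-vanishing, and let $(M_1,\dots,M_m)=\big(\mathsf m_1,\tfrac{\mathsf m_1}{\mathsf m_2},\tfrac{\mathsf m_3}{\mathsf m_2},\tfrac{\mathsf m_3}{\mathsf m_4},\dots\big)$. Let $\widehat K_1$ (from functions on $\Omega_2$ to functions on $\Omega_1$) and $\widehat K_2$ (from functions on $\Omega_1$ to functions on $\Omega_2$) have the kernels $$\widehat K_1(u,v)=\big(\delta_i(j)+\delta_i(j+(-1)^i)\big)\frac{M_i(u)A_i(u)B_j(v)}{u-v},\qquad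 u\in\Omega_{1,i},\ v\in\Omega_{2,j},$$ $$\widehat K_2(u,v)=\big(\delta_i(j)+\delta_i(j-(-1)^i)\big)\frac{M_i(u)^{-1}A_i(u)B_j(v)}{u-v},\qquad u\in\Omega_{2,i},\ v\in\Omega_{1,j},$$ where $\delta_i(j)=1$ if $i=j$ and $0$ otherwise. Let $U=\begin{pmatrix}1&1\\0&0\end{pmatrix}$. Define the $m\times m$ matrices $\Lambda_1=\mathrm{diag}(U,\dots,U)$ for $m$ even and $\mathrm{diag}(U,\dots,U,1)$ for $m$ odd; $\Lambda_2=\mathrm{diag}(1,U,\dots,U,1)$ for $m$ even and $\mathrm{diag}(1,U,\dots,U)$ for $m$ odd; $E_{11}=\mathrm{diag}(1,0,\dots,0)$; and the $(m+1)\times 2m$ matrix $P=(I_{m+1}\ \ 0)$. With $\mathbf A=\mathrm{diag}(A_j)$, $\mathbf B=\mathrm{diag}(B_j)$, $\chi_\ell=\mathrm{diag}(\mathbf 1_{\Omega_{\ell,j}})$ and $e=(1,\dots,1)^T\in\mathbb R^m$, put $$F=P\begin{pmatrix}\Lambda_1&\Lambda_2-E_{11}\\0&E_{11}\end{pmatrix}\begin{pmatrix}\mathbf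 A\chi_1e\\ \mathbf A\chi_2e\end{pmatrix},\qquad G=P\begin{pmatrix}\Lambda_1&\Lambda_2-E_{11}\\0&E_{11}\end{pmatrix}\begin{pmatrix}\mathbf B\chi_2e\\ \mathbf B\chi_1e\end{pmatrix},$$ $\Delta=\mathrm{diag}(\mathsf m_1,\dots,\mathsf m_m,1)$, $f=c\,\Delta F$ and $g=c^{-1}\Delta^{-1}G$, which are functions $\Omega\to\mathbb C^{m+1}$. Let $H$ be the integral operator on $L^2(\Omega,d\mu)$ with kernel $H(u,v)=\dfrac{f(u)^Tg(v)}{u-v}$ for $u\ne v$ and $H(u,u)=0$. If the Fredholm series $$\det(I-\widehat K_1\widehat K_2)=\sum_{n\ge0}\frac{(-1)^n}{n!}\int_{\Omega_1^n}\det\big[(\widehat K_1\widehat K_2)(x_i,x_j)\big]_{i,j=1}^n\,d\mu(x_1)\cdots d\mu(x_n)$$ is well defined (absolutely convergent integrals and absolutely convergent series), where $(\widehat K_1\widehat K_2)(u,w)=\int_{\Omega_2}\widehat K_1(u,v)\widehat K_2(v,w)\,d\mu(v)$, and if $H$ is a trace class operator, then $$\det(I-\widehat K_1\widehat K_2)=\det(I-H),$$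 where $\det(I-H)=\sum_{k\ge0}(-1)^k\,\mathrm{tr}(\Lambda^kH)$ is the Fredholm determinant of the trace class operator $H$. Furthermore (without these two assumptions), $f_i(z)g_i(z)=0$ for every $z\in\Omega$ and $i\in\{1,\dots,m+1\}$. -/

import Mathlib

open MeasureTheory Set Filter Topology
open scoped ENNReal Matrix

universe uE

/-! ### Trace class operators and their Fredholm determinants -/

section TraceClass

variable {E : Type uE} [NormedAddCommGroup E] [InnerProductSpace ℂ E] [CompleteSpace E]

/-- `T` is a trace class (equivalently, on a Hilbert space, nuclear) operator:
`T = ∑ₙ ⟨aₙ, ·⟩ bₙ` with `∑ₙ ‖aₙ‖ ‖bₙ‖ < ∞`. -/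
def IsTraceClass (T : E →L[ℂ] E) : Prop :=
  ∃ a b : ℕ → E, Summable (fun n => ‖a n‖ * ‖b n‖) ∧
    ∀ x : E, HasSum (fun n => inner ℂ (a n) x • b n) (T x)

open Classical in
/-- The principal minor `det (⟨eᵢ, T eⱼ⟩)_{i, j ∈ s}` of `T` in the Hilbert basis `e`. It is the
diagonal matrix entry of the exterior power `Λ^{|s|} T` at the basis vector `⋀_{i ∈ s} eᵢ`. -/
noncomputable def principalMinor {ι : Type uE} (e : HilbertBasis ι ℂ E) (T : E →L[ℂ] E)
    (s : Finset ι) : ℂ :=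
  (Matrix.of fun i j : s => inner ℂ (e i) (T (e j))).det

/-- `det (1 - T) = d` for the operator-theoretic Fredholm determinant
`det (1 - T) = ∑ₖ (-1)ᵏ tr (Λᵏ T)`: in every Hilbert basis of the space, the series of the signed
principal minors of `T` over all finite sets of basis indices converges (unconditionally) to `d`. -/
def HasFredholmDet (T : E →L[ℂ] E) (d : ℂ) : Prop :=
  ∀ (ι : Type uE) (e : HilbertBasis ι ℂ E),
    HasSum (fun s : Finset ι => (-1 : ℂ) ^ s.card * principalMinor e T s) d

end TraceClass

/-! ### Integral operators and Fredholm series with respect to `dμ = τ dρ`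

Here `ρ` is a positive measure and `τ` a unimodular weight: `τ = 1` and `ρ` the counting measure for
discrete sets, and `τ` the unit tangent and `ρ` the arc length for oriented contours (`dz = τ |dz|`).
The Hilbert space is `L²(ρ)`. -/

section Kernels

/-- `T` is the integral operator on `L²(ρ)` with kernel `K`:
`(T φ)(u) = ∫ K(u, v) φ(v) dμ(v)` for almost every `u`, where `dμ = τ dρ`. -/
def IsIntegralOperator (ρ : Measure ℂ) (τ : ℂ → ℂ) (K : ℂ → ℂ → ℂ)
    (T : Lp ℂ 2 ρ →L[ℂ] Lp ℂ 2 ρ) : Prop :=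
  ∀ φ : Lp ℂ 2 ρ, ∀ᵐ u ∂ρ,
    Integrable (fun v => K u v * φ v * τ v) ρ ∧ T φ u = ∫ v, K u v * φ v * τ v ∂ρ

/-- The kernel `∫ K(u, v) L(v, w) dμ(v)` of the product of two integral operators. -/
noncomputable def compKernel (ρ : Measure ℂ) (τ : ℂ → ℂ) (K L : ℂ → ℂ → ℂ) (u w : ℂ) : ℂ :=
  ∫ v, K u v * L v w * τ v ∂ρ

/-- The integrand `det (K(xᵢ, xⱼ)) ∏ᵢ τ(xᵢ)`, `1 ≤ i, j ≤ n`, of the Fredholm series. -/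
noncomputable def fredholmIntegrand (τ : ℂ → ℂ) (K : ℂ → ℂ → ℂ) (n : ℕ) (x : Fin n → ℂ) : ℂ :=
  (Matrix.of fun i j => K (x i) (x j)).det * ∏ i, τ (x i)

/-- The `n`-th term `((-1)ⁿ / n!) ∫ det (K(xᵢ, xⱼ)) dμ(x₁) ⋯ dμ(xₙ)` of the Fredholm series. -/
noncomputable def fredholmTerm (ρ : Measure ℂ) (τ : ℂ → ℂ) (K : ℂ → ℂ → ℂ) (n : ℕ) : ℂ :=
  (-1 : ℂ) ^ n / (n.factorial : ℂ) *
    ∫ x, fredholmIntegrand τ K n x ∂(Measure.pi fun _ : Fin n => ρ)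

/-- The Fredholm series expansion of `det (1 - K)` is well defined: all its integrals converge
absolutely, and so does the series. -/
def FredholmSeriesWellDefined (ρ : Measure ℂ) (τ : ℂ → ℂ) (K : ℂ → ℂ → ℂ) : Prop :=
  (∀ n, Integrable (fredholmIntegrand τ K n) (Measure.pi fun _ : Fin n => ρ)) ∧
    Summable (fredholmTerm ρ τ K)

/-- The Fredholm series
`det (1 - K) = ∑ₙ ((-1)ⁿ / n!) ∫ det (K(xᵢ, xⱼ)) dμ(x₁) ⋯ dμ(xₙ)`. -/
noncomputable def fredholmSeries (ρ : Measure ℂ) (τ : ℂ → ℂ) (K : ℂ → ℂ → ℂ) : ℂ :=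
  ∑' n, fredholmTerm ρ τ K n

end Kernels

/-! ### Contours -/

/-- `S` is a finite union of regular simple `C¹` arcs (open, closed or half-open, bounded or
unbounded; hence also a finite union of piecewise `C¹` contours, closed or not), and the orientation
of the arcs is given by the unit tangent field `τ`: `γ'(t) = |γ'(t)| τ(γ(t))` for almost every `t`. -/
def IsContourUnion (τ : ℂ → ℂ) (S : Set ℂ) : Prop :=
  ∃ (n : ℕ) (J : Fin n → Set ℝ) (γ : Fin n → ℝ → ℂ),
    (∀ i, (J i).OrdConnected ∧ ContDiffOn ℝ 1 (γ i) (J i) ∧ InjOn (γ i) (J i) ∧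
      (∀ t ∈ J i, derivWithin (γ i) (J i) t ≠ 0) ∧
      ∀ᵐ t ∂(volume.restrict (J i)),
        derivWithin (γ i) (J i) t = (‖derivWithin (γ i) (J i) t‖ : ℂ) * τ (γ i t)) ∧
    S = ⋃ i, γ i '' J i

/-! ### The operators -/

/-- The sets and functions from which the operators are built: `Ω₁ j = Ω_{1,j}`, `Ω₂ j = Ω_{2,j}`,
`A j`, `B j`, the functions `w j` whose ratios enter the kernels (written `𝗆_j` in words below), and
the scalar function `c`. An index `j : Fin m` stands for the index `j + 1 ∈ {1, …, m}`. Only the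
values of the functions on the union of the sets matter. -/
structure BlockData (m : ℕ) where
  /-- the sets `Ω_{1,j}` -/
  Ω₁ : Fin m → Set ℂ
  /-- the sets `Ω_{2,j}` -/
  Ω₂ : Fin m → Set ℂ
  /-- the functions `A_j` -/
  A : Fin m → ℂ → ℂ
  /-- the functions `B_j` -/
  B : Fin m → ℂ → ℂ
  /-- the functions `𝗆_j` -/
  w : Fin m → ℂ → ℂ
  /-- the conjugating scalar function -/
  c : ℂ → ℂ

namespace BlockData

variable {m : ℕ} (D : BlockData m)

/-- `Ω₁ = ⋃ⱼ Ω_{1,j}` -/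
def Omega₁ : Set ℂ := ⋃ j, D.Ω₁ j

/-- `Ω₂ = ⋃ⱼ Ω_{2,j}` -/
def Omega₂ : Set ℂ := ⋃ j, D.Ω₂ j

/-- `Ω = Ω₁ ∪ Ω₂` -/
def Omega : Set ℂ := D.Omega₁ ∪ D.Omega₂

/-- The measure `dμ = τ dρ` is the counting measure, and all sets are discrete. -/
def IsDiscreteSetting (ρ : Measure ℂ) (τ : ℂ → ℂ) : Prop :=
  (∀ j, IsDiscrete (D.Ω₁ j)) ∧ (∀ j, IsDiscrete (D.Ω₂ j)) ∧
    ρ = Measure.count.restrict D.Omega ∧ τ = fun _ => 1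

/-- The measure `dμ = τ dρ` is `dz`, and all sets are finite unions of contours: `ρ` is the arc
length (one-dimensional Hausdorff) measure on the union `Ω`, and `τ` the oriented unit tangent. -/
def IsContourSetting (ρ : Measure ℂ) (τ : ℂ → ℂ) : Prop :=
  Measurable τ ∧ (∀ z, ‖τ z‖ = 1) ∧
    (∀ j, IsContourUnion τ (D.Ω₁ j)) ∧ (∀ j, IsContourUnion τ (D.Ω₂ j)) ∧
    ρ = (Measure.hausdorffMeasure 1).restrict D.Omega

/-- The diagonal entries of
`M(z) = diag (𝗆₁, 𝗆₁ / 𝗆₂, 𝗆₃ / 𝗆₂, 𝗆₃ / 𝗆₄, 𝗆₅ / 𝗆₄, …)`. -/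
noncomputable def M (i : Fin m) (z : ℂ) : ℂ :=
  if (i : ℕ) = 0 then D.w i z
  else if Even ((i : ℕ) + 1) then D.w ⟨(i : ℕ) - 1, by omega⟩ z / D.w i z
  else D.w i z / D.w ⟨(i : ℕ) - 1, by omega⟩ z

/-- Kronecker's `δ_a(b)` -/
def kron (a b : ℤ) : ℂ := if a = b then 1 else 0

open Classical in
/-- The kernel `(δ_i(j) + δ_i(j + (-1)^i)) M_i(u) A_i(u) B_j(v) / (u - v)` for `u ∈ Ω_{1,i}`,
`v ∈ Ω_{2,j}`, with `i, j` counted from `1`. -/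
noncomputable def K₁ (u v : ℂ) : ℂ :=
  ∑ i : Fin m, ∑ j : Fin m,
    if u ∈ D.Ω₁ i ∧ v ∈ D.Ω₂ j then
      (kron ((i : ℤ) + 1) ((j : ℤ) + 1) +
          kron ((i : ℤ) + 1) ((j : ℤ) + 1 + (-1) ^ ((i : ℕ) + 1))) *
        (D.M i u * D.A i u * D.B j v / (u - v))
    else 0

open Classical in
/-- The kernel `(δ_i(j) + δ_i(j - (-1)^i)) M_i(u)⁻¹ A_i(u) B_j(v) / (u - v)` for `u ∈ Ω_{2,i}`,
`v ∈ Ω_{1,j}`, with `i, j` counted from `1`. -/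
noncomputable def K₂ (u v : ℂ) : ℂ :=
  ∑ i : Fin m, ∑ j : Fin m,
    if u ∈ D.Ω₂ i ∧ v ∈ D.Ω₁ j then
      (kron ((i : ℤ) + 1) ((j : ℤ) + 1) +
          kron ((i : ℤ) + 1) ((j : ℤ) + 1 - (-1) ^ ((i : ℕ) + 1))) *
        ((D.M i u)⁻¹ * D.A i u * D.B j v / (u - v))
    else 0

/-- `Λ₁ = diag (U, …, U)` (`m` even) or `diag (U, …, U, 1)` (`m` odd), where `U = !![1, 1; 0, 0]`:
with indices from `1`, each odd row `k` has the entry `1` in the columns `k` and `k + 1`. -/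
def Lam₁ (m : ℕ) : Matrix (Fin m) (Fin m) ℂ :=
  Matrix.of fun i j =>
    if Odd ((i : ℕ) + 1) ∧ ((j : ℕ) = i ∨ (j : ℕ) = i + 1) then 1 else 0

/-- `Λ₂ = diag (1, U, …, U, 1)` (`m` even) or `diag (1, U, …, U)` (`m` odd): with indices from `1`,
the first row is `(1, 0, …, 0)`, and each even row `k` has the entry `1` in the columns `k` and
`k + 1`. -/
def Lam₂ (m : ℕ) : Matrix (Fin m) (Fin m) ℂ :=
  Matrix.of fun i j =>
    if ((i : ℕ) = 0 ∧ (j : ℕ) = 0) ∨ (Even ((i : ℕ) + 1) ∧ ((j : ℕ) = i ∨ (j : ℕ) = i + 1))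
    then 1 else 0

/-- `E₁₁ = diag (1, 0, …, 0)` -/
def E₁₁ (m : ℕ) : Matrix (Fin m) (Fin m) ℂ :=
  Matrix.of fun i j => if (i : ℕ) = 0 ∧ (j : ℕ) = 0 then 1 else 0

/-- The `(m + 1) × 2m` matrix `(I_{m+1}  0)`; the `2m` columns are indexed by `Fin m ⊕ Fin m`. -/
def P (m : ℕ) : Matrix (Fin (m + 1)) (Fin m ⊕ Fin m) ℂ :=
  Matrix.of fun i k =>
    if (i : ℕ) = Sum.elim (fun j : Fin m => (j : ℕ)) (fun j : Fin m => m + (j : ℕ)) k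
    then 1 else 0

/-- The `2m × 2m` matrix with the blocks `Λ₁, Λ₂ - E₁₁; 0, E₁₁`. -/
def L (m : ℕ) : Matrix (Fin m ⊕ Fin m) (Fin m ⊕ Fin m) ℂ :=
  Matrix.fromBlocks (Lam₁ m) (Lam₂ m - E₁₁ m) 0 (E₁₁ m)

/-- `F(z) = P (Λ₁, Λ₂ - E₁₁; 0, E₁₁) (A χ₁ e; A χ₂ e)` -/
noncomputable def F (z : ℂ) : Fin (m + 1) → ℂ :=
  (P m * L m) *ᵥ Sum.elim (fun j => D.A j z * (D.Ω₁ j).indicator 1 z)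
    (fun j => D.A j z * (D.Ω₂ j).indicator 1 z)

/-- `G(z) = P (Λ₁, Λ₂ - E₁₁; 0, E₁₁) (B χ₂ e; B χ₁ e)` -/
noncomputable def G (z : ℂ) : Fin (m + 1) → ℂ :=
  (P m * L m) *ᵥ Sum.elim (fun j => D.B j z * (D.Ω₂ j).indicator 1 z)
    (fun j => D.B j z * (D.Ω₁ j).indicator 1 z)

/-- `Δ(z) = diag (𝗆₁(z), …, 𝗆ₘ(z), 1)` -/
def Delta (z : ℂ) : Matrix (Fin (m + 1)) (Fin (m + 1)) ℂ :=
  Matrix.diagonal (Fin.snoc (α := fun _ => ℂ) (fun j : Fin m => D.w j z) 1)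

/-- `f = c Δ F` -/
noncomputable def f (z : ℂ) : Fin (m + 1) → ℂ := D.c z • (D.Delta z *ᵥ D.F z)

/-- `g = c⁻¹ Δ⁻¹ G` -/
noncomputable def g (z : ℂ) : Fin (m + 1) → ℂ := (D.c z)⁻¹ • ((D.Delta z)⁻¹ *ᵥ D.G z)

open Classical in
/-- The kernel `f(u)ᵀ g(v) / (u - v)` for `u ≠ v`, and `0` for `u = v`. -/
noncomputable def H (u v : ℂ) : ℂ :=
  if u = v then 0 else (D.f u ⬝ᵥ D.g v) / (u - v)

end BlockData

/-!
On each of the sets `Ω_{ℓ,j}` the vectors `f` and `g` are multiples of two different coordinate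
vectors, hence `fᵢ gᵢ = 0`. Moreover `f ⬝ g` vanishes on `Ω₁ × Ω₁` and on `Ω₂ × Ω₂`, so that `H` is
off-diagonal with respect to `L²(Ω) = L²(Ω₁) ⊕ L²(Ω₂)`, and conjugation by a non-vanishing function
turns its two blocks into `K₁` and `K₂`. What has to be shown is therefore the block determinant
formula `det (1 - T) = det (1 - P T (1 - P) T P)` for an off-diagonal trace class operator `T`,
where `P` is the projection to `L²(Ω₁)`, together with the identification of the right-hand side
with a Fredholm series.

Both follow from an expansion `T = ∑ₙ ⟨aₙ, ·⟩ bₙ`: Hadamard's inequality bounds the minors of the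
Gram matrix `(⟨aᵢ, bⱼ⟩)`, so that `det (1 - T)` is the limit of determinants of finite matrices. For
an off-diagonal `T` the expansion can be chosen with a Gram matrix of the form `(0, X; Y, 0)`, and
`det (1, -X; -Y, 1) = det (1 - X Y)`. Finally the kernel of `P T (1 - P) T P` is given almost
everywhere by a sum `∑ₙ xₙ(u) conj (aₙ(w))`, and integrating its determinants turns them into sums
of Gram determinants.
-/

/-! ### Determinants -/

section Determinants

variable {𝕜 E : Type*} [RCLike 𝕜] [NormedAddCommGroup E] [InnerProductSpace 𝕜 E]

variable (𝕜) in
/-- The mixed Gram matrix `(⟨aᵢ, bⱼ⟩)` of two families of vectors. -/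
def crossGram {ι : Type*} (a b : ι → E) : Matrix ι ι 𝕜 := Matrix.of fun i j => inner 𝕜 (a i) (b j)

/-- Hadamard's inequality: both determinants are compared through the Gram–Schmidt basis of `f`, in
which `f` is triangular. -/
theorem norm_toBasis_det_le_prod_norm {k : ℕ} (u : OrthonormalBasis (Fin k) 𝕜 E) (f : Fin k → E) :
    ‖u.toBasis.det f‖ ≤ ∏ i, ‖f i‖ := by
  have := u.toBasis.finiteDimensional_of_finite
  have hrank : Module.finrank 𝕜 E = Fintype.card (Fin k) := Module.finrank_eq_card_basis u.toBasis
  set v := InnerProductSpace.gramSchmidtOrthonormalBasis hrank f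
  rw [AlternatingMap.eq_smul_basis_det v.toBasis u.toBasis.det, AlternatingMap.smul_apply,
    InnerProductSpace.gramSchmidtOrthonormalBasis_det, norm_smul, v.coe_toBasis,
    u.det_to_matrix_orthonormalBasis v, one_mul, norm_prod]
  refine Finset.prod_le_prod (fun _ _ => norm_nonneg _) fun i _ => ?_
  simpa using norm_inner_le_norm (𝕜 := 𝕜) (v i) (f i)

theorem crossGram_eq_conjTranspose_mul {ι κ : Type*} [Fintype ι] (u : OrthonormalBasis ι 𝕜 E)
    (a b : κ → E) :
    crossGram 𝕜 a b = (u.toBasis.toMatrix a)ᴴ * u.toBasis.toMatrix b := by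
  ext i j
  simp only [crossGram, Matrix.mul_apply, Matrix.of_apply, Matrix.conjTranspose_apply,
    Module.Basis.toMatrix_apply, OrthonormalBasis.coe_toBasis_repr_apply,
    OrthonormalBasis.repr_apply_apply, RCLike.star_def, inner_conj_symm, u.sum_inner_mul_inner]

theorem det_crossGram_eq_zero {ι : Type*} [Fintype ι] [DecidableEq ι] (a : ι → E) {b : ι → E}
    (hb : ¬ LinearIndependent 𝕜 b) : (crossGram 𝕜 a b).det = 0 := by
  obtain ⟨g, hg, i, hi⟩ := Fintype.not_linearIndependent_iff.1 hb
  refine Matrix.exists_mulVec_eq_zero_iff.1 ⟨g, fun h => hi (congrFun h i), ?_⟩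
  ext j
  have : inner 𝕜 (a j) (∑ i, g i • b i) = 0 := by rw [hg, inner_zero_right]
  simpa [crossGram, inner_sum, inner_smul_right, Matrix.mulVec, dotProduct, mul_comm] using this

theorem norm_det_crossGram_le {k : ℕ} (a b : Fin k → E) :
    ‖(crossGram 𝕜 a b).det‖ ≤ (∏ i, ‖a i‖) * ∏ i, ‖b i‖ := by
  by_cases hb : LinearIndependent 𝕜 b
  swap
  · rw [det_crossGram_eq_zero a hb, norm_zero]
    positivity
  set W := Submodule.span 𝕜 (range b)
  have : FiniteDimensional 𝕜 W := FiniteDimensional.span_of_finite 𝕜 (finite_range b)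
  let b' : Fin k → W := fun i => ⟨b i, Submodule.subset_span (mem_range_self i)⟩
  let a' : Fin k → W := fun i => W.orthogonalProjectionOnto (a i)
  let u : OrthonormalBasis (Fin k) 𝕜 W :=
    InnerProductSpace.gramSchmidtOrthonormalBasis (finrank_span_eq_card hb) b'
  have hW : crossGram 𝕜 a b = crossGram 𝕜 a' b' := by
    ext i j
    exact (W.inner_orthogonalProjectionOnto_eq_of_mem_right (b' j) (a i)).symm
  rw [hW, crossGram_eq_conjTranspose_mul u, Matrix.det_mul, Matrix.det_conjTranspose, norm_mul,
    norm_star]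
  refine mul_le_mul ?_ (norm_toBasis_det_le_prod_norm u b') (norm_nonneg _) (by positivity)
  exact (norm_toBasis_det_le_prod_norm u a').trans <| Finset.prod_le_prod
    (fun _ _ => norm_nonneg _) fun i _ => W.norm_orthogonalProjectionOnto_apply_le (a i)

end Determinants

section PrincipalMinors

variable {κ : Type*}

theorem det_submatrix_of_not_injective {R : Type*} [CommRing R] {k : ℕ} (M : Matrix κ κ R)
    {t : Fin k → κ} (ht : ¬ Function.Injective t) : (M.submatrix t t).det = 0 := by
  simp only [Function.Injective, not_forall] at ht
  obtain ⟨i, j, hij, hne⟩ := ht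
  exact Matrix.det_zero_of_row_eq hne (by ext l; simp [hij])

variable [DecidableEq κ]

theorem det_submatrix_image_of_injective {R : Type*} [CommRing R] {k : ℕ} (M : Matrix κ κ R)
    {t : Fin k → κ} (ht : Function.Injective t) :
    (M.submatrix ((↑) : Finset.univ.image t → κ) (↑)).det = (M.submatrix t t).det := by
  let e : Fin k ≃ Finset.univ.image t := Equiv.ofBijective
    (fun i => ⟨t i, Finset.mem_image_of_mem t (Finset.mem_univ i)⟩)
    ⟨fun i j hij => ht (Subtype.ext_iff.1 hij), fun ⟨x, hx⟩ => by
      obtain ⟨i, -, rfl⟩ := Finset.mem_image.1 hx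
      exact ⟨i, rfl⟩⟩
  exact (Matrix.det_submatrix_equiv_self e _).symm

theorem card_image_univ_eq_iff {k : ℕ} {t : Fin k → κ} :
    (Finset.univ.image t).card = k ↔ Function.Injective t := by
  simpa using Finset.card_image_iff (s := Finset.univ) (f := t)

variable [Fintype κ]

theorem card_filter_image_univ_eq (s : Finset κ) :
    (Finset.univ.filter fun t : Fin s.card → κ => Finset.univ.image t = s).card =
      s.card.factorial := by
  have hcard : (Finset.univ : Finset (Fin s.card ↪ s)).card = s.card.factorial := by
    rw [Finset.card_univ, Fintype.card_embedding_eq, Fintype.card_coe, Fintype.card_fin,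
      Nat.descFactorial_self]
  rw [← hcard]
  symm
  refine Finset.card_bij (fun e _ i => (e i : κ)) (fun e _ => ?_)
    (fun e _ e' _ h => by ext i; exact congrFun h i) fun t ht => ?_
  · refine Finset.mem_filter.2 ⟨Finset.mem_univ _, Finset.eq_of_subset_of_card_le ?_ ?_⟩
    · exact Finset.image_subset_iff.2 fun i _ => (e i).2
    · exact (card_image_univ_eq_iff.2 (Subtype.val_injective.comp e.injective)).ge
  · have himage := (Finset.mem_filter.1 ht).2
    have hinj : Function.Injective t := card_image_univ_eq_iff.1 (congrArg Finset.card himage)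
    exact ⟨⟨fun i => ⟨t i, himage ▸ Finset.mem_image_of_mem t (Finset.mem_univ i)⟩,
      fun i j hij => hinj (Subtype.ext_iff.1 hij)⟩, Finset.mem_univ _, rfl⟩

theorem factorial_nsmul_sum_minors {R A : Type*} [CommRing R] [AddCommMonoid A] (M : Matrix κ κ R)
    {φ : R → A} (hφ : φ 0 = 0) (k : ℕ) :
    k.factorial • ∑ s ∈ Finset.powersetCard k (Finset.univ : Finset κ),
        φ (M.submatrix ((↑) : s → κ) (↑)).det =
      ∑ t : Fin k → κ, φ (M.submatrix t t).det := by
  have hinjective : ∑ t : Fin k → κ with Function.Injective t, φ (M.submatrix t t).det =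
      ∑ t : Fin k → κ, φ (M.submatrix t t).det := by
    refine Finset.sum_filter_of_ne fun t _ ht => ?_
    contrapose! ht
    rw [det_submatrix_of_not_injective M ht, hφ]
  have hmaps : ∀ t ∈ Finset.univ.filter (fun t : Fin k → κ => Function.Injective t),
      Finset.univ.image t ∈ Finset.powersetCard k (Finset.univ : Finset κ) := fun t ht =>
    Finset.mem_powersetCard.2
      ⟨Finset.subset_univ _, card_image_univ_eq_iff.2 (Finset.mem_filter.1 ht).2⟩
  rw [← hinjective, ← Finset.sum_fiberwise_of_maps_to hmaps, Finset.smul_sum]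
  refine Finset.sum_congr rfl fun s hs => ?_
  obtain rfl := (Finset.mem_powersetCard.1 hs).2
  have hfiber : (Finset.univ.filter fun t : Fin s.card → κ => Function.Injective t ∧
      Finset.univ.image t = s) = Finset.univ.filter fun t => Finset.univ.image t = s :=
    Finset.filter_congr fun t _ => and_iff_right_of_imp fun h =>
      card_image_univ_eq_iff.1 (congrArg Finset.card h)
  rw [← card_filter_image_univ_eq s, ← Finset.sum_const, Finset.filter_filter, hfiber]
  refine Finset.sum_congr rfl fun t ht => ?_
  have himage := (Finset.mem_filter.1 ht).2
  rw [← det_submatrix_image_of_injective M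
    (card_image_univ_eq_iff.1 (congrArg Finset.card himage)), himage]

theorem det_one_sub_eq_sum_minors {R : Type*} [CommRing R] (M : Matrix κ κ R) :
    (1 - M).det = ∑ s : Finset κ, (-1) ^ s.card * (M.submatrix ((↑) : s → κ) (↑)).det := by
  have hadd : (1 - M).det =
      Matrix.detRowAlternating ((-M).row + (1 : Matrix κ κ R).row) := by
    rw [sub_eq_neg_add]
    rfl
  rw [hadd, AlternatingMap.map_add_univ]
  refine Finset.sum_congr rfl fun s _ => ?_
  refine (Matrix.det_piecewise_one_eq_submatrix_det (-M) s).trans ?_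
  rw [Matrix.submatrix_neg, Pi.neg_apply, Pi.neg_apply, Matrix.det_neg, Fintype.card_coe]

theorem hasSum_det_one_sub {R : Type*} [Field R] [CharZero R] [TopologicalSpace R]
    (M : Matrix κ κ R) :
    HasSum (fun k : ℕ => (-1) ^ k / (k.factorial : R) * ∑ t : Fin k → κ, (M.submatrix t t).det)
      (1 - M).det := by
  have hminors : (1 - M).det = ∑ k ∈ Finset.range (Fintype.card κ + 1),
      (-1) ^ k / (k.factorial : R) * ∑ t : Fin k → κ, (M.submatrix t t).det := by
    rw [det_one_sub_eq_sum_minors, ← Finset.powerset_univ, Finset.sum_powerset, Finset.card_univ]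
    refine Finset.sum_congr rfl fun k _ => ?_
    have hk : (k.factorial : R) ≠ 0 := by exact_mod_cast k.factorial_ne_zero
    have htuples := factorial_nsmul_sum_minors M (φ := id) rfl k
    simp only [id, nsmul_eq_mul] at htuples
    rw [← htuples, ← mul_assoc, div_mul_cancel₀ _ hk, Finset.mul_sum]
    exact Finset.sum_congr rfl fun s hs => by rw [(Finset.mem_powersetCard.1 hs).2]
  rw [hminors]
  refine hasSum_sum_of_ne_finset_zero fun k hk => ?_
  rw [Finset.sum_eq_zero fun t _ => det_submatrix_of_not_injective M fun ht => hk ?_, mul_zero]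
  have hcard := Fintype.card_le_of_injective t ht
  rw [Fintype.card_fin] at hcard
  exact Finset.mem_range.2 (Nat.lt_succ_of_le hcard)

end PrincipalMinors

/-! ### Expansions of determinants of series and integrals -/

section Andreief

variable {𝕜 : Type*} [RCLike 𝕜] {k : ℕ}

theorem hasSum_prod_apply {ι : Type*} {f : Fin k → ι → 𝕜} {a : Fin k → 𝕜}
    (hf : ∀ i, HasSum (f i) (a i)) :
    HasSum (fun ν : Fin k → ι => ∏ i, f i (ν i)) (∏ i, a i) := by
  induction k with
  | zero => simp
  | succ k ih =>
    have htail := ih fun i : Fin k => hf i.succ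
    have hsum : Summable fun p : ι × (Fin k → ι) =>
        f 0 p.1 * (fun ν : Fin k → ι => ∏ i : Fin k, f i.succ (ν i)) p.2 :=
      ((hf 0).summable.norm.mul_norm htail.summable.norm).of_norm
    let e : ι × (Fin k → ι) ≃ (Fin (k + 1) → ι) := Fin.consEquiv fun _ : Fin (k + 1) => ι
    have he : ∀ p : ι × (Fin k → ι),
        ∏ i, f i (e p i) = f 0 p.1 * ∏ i : Fin k, f i.succ (p.2 i) := fun p => by
      rw [Fin.prod_univ_succ]
      rfl
    rw [Fin.prod_univ_succ]
    refine e.hasSum_iff.1 ?_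
    simpa only [Function.comp_def, he] using (hf 0).mul htail hsum

theorem hasSum_prod_pow {ι : Type*} {r : ι → 𝕜} (hr : Summable r) (k : ℕ) :
    HasSum (fun ν : Fin k → ι => ∏ i, r (ν i)) ((∑' n, r n) ^ k) := by
  simpa using hasSum_prod_apply fun _ : Fin k => hr.hasSum

theorem prod_mul_det_eq_sum_perm {R : Type*} [CommRing R] (φ : Fin k → R)
    (M : Matrix (Fin k) (Fin k) R) :
    (∏ i, φ i) * M.det =
      ∑ σ : Equiv.Perm (Fin k), ((Equiv.Perm.sign σ : ℤ) : R) * ∏ i, φ i * M i (σ i) := by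
  rw [← Matrix.det_transpose, Matrix.det_apply', Finset.mul_sum]
  simp only [Finset.prod_mul_distrib, Matrix.transpose_apply, mul_left_comm]

/-- The Cauchy–Binet formula for products of infinite matrices. -/
theorem hasSum_prod_mul_det {ι : Type*} {φ ψ : Fin k → ι → 𝕜} {M : Matrix (Fin k) (Fin k) 𝕜}
    (h : ∀ i j, HasSum (fun n => φ i n * ψ j n) (M i j)) :
    HasSum (fun ν : Fin k → ι => (∏ i, φ i (ν i)) * (Matrix.of fun i j => ψ j (ν i)).det)
      M.det := by
  simp_rw [prod_mul_det_eq_sum_perm, Matrix.of_apply]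
  rw [← Matrix.det_transpose, Matrix.det_apply']
  exact hasSum_sum fun σ _ => (hasSum_prod_apply fun i => h i (σ i)).mul_left _

theorem sum_prod_mul_det {κ : Type*} [Fintype κ] (φ ψ : Fin k → κ → 𝕜) :
    ∑ t : Fin k → κ, (∏ i, φ i (t i)) * (Matrix.of fun i j => ψ j (t i)).det =
      (Matrix.of fun i j => ∑ x, φ i x * ψ j x).det := by
  classical
  exact (hasSum_fintype _).unique (hasSum_prod_mul_det fun i j => hasSum_fintype _)

theorem sum_det_mul_det {κ : Type*} [Fintype κ] (φ ψ : Fin k → κ → 𝕜) :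
    ∑ t : Fin k → κ, (Matrix.of fun i j => φ i (t j)).det * (Matrix.of fun i j => ψ j (t i)).det =
      k.factorial * (Matrix.of fun i j => ∑ x, φ i x * ψ j x).det := by
  have hperm : ∀ σ : Equiv.Perm (Fin k), ((Equiv.Perm.sign σ : ℤ) : 𝕜) * ∑ t : Fin k → κ,
      (∏ i, φ (σ i) (t i)) * (Matrix.of fun i j => ψ j (t i)).det =
        (Matrix.of fun i j => ∑ x, φ i x * ψ j x).det := fun σ => by
    rw [sum_prod_mul_det (fun i => φ (σ i)) ψ]
    refine (congrArg _
      (Matrix.det_permute σ (Matrix.of fun i j => ∑ x, φ i x * ψ j x))).trans ?_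
    rw [← mul_assoc, ← Int.cast_mul, Int.units_coe_mul_self,
      Int.cast_one, one_mul]
  have hexpand : ∀ t : Fin k → κ,
      (Matrix.of fun i j => φ i (t j)).det * (Matrix.of fun i j => ψ j (t i)).det =
        ∑ σ : Equiv.Perm (Fin k), ((Equiv.Perm.sign σ : ℤ) : 𝕜) *
          ((∏ i, φ (σ i) (t i)) * (Matrix.of fun i j => ψ j (t i)).det) := fun t => by
    rw [Matrix.det_apply', Finset.sum_mul]
    simp only [Matrix.of_apply, mul_assoc]
  simp_rw [hexpand]
  rw [Finset.sum_comm]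
  simp_rw [← Finset.mul_sum, hperm]
  simp [Fintype.card_perm]

section Measure

variable {X : Type*} [MeasurableSpace X] {μ : Measure X}

theorem integrable_of_ae_hasSum {ι G : Type*} [Countable ι] [NormedAddCommGroup G]
    {F : ι → X → G} {f : X → G} (hF : ∀ i, Integrable (F i) μ)
    (hsum : Summable fun i => ∫ x, ‖F i x‖ ∂μ) (h : ∀ᵐ x ∂μ, HasSum (fun i => F i x) (f x)) :
    Integrable f μ := by
  refine ⟨aestronglyMeasurable_of_tendsto_ae atTop
    (fun s => Finset.aestronglyMeasurable_fun_sum s fun i _ => (hF i).1) h, ?_⟩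
  have hle : ∀ᵐ x ∂μ, ‖f x‖ₑ ≤ ∑' i, ‖F i x‖ₑ := h.mono fun x hx => by
    rw [← hx.tsum_eq]
    exact enorm_tsum_le_tsum_enorm
  refine (lintegral_mono_ae hle).trans_lt ?_
  rw [lintegral_tsum fun i => (hF i).1.enorm]
  simp_rw [← ofReal_integral_norm_eq_lintegral_enorm (hF _)]
  exact hsum.tsum_ofReal_lt_top

variable [SigmaFinite μ]

theorem integrable_prod_mul_apply_perm {φ ψ : Fin k → X → 𝕜}
    (h : ∀ i j, Integrable (fun x => φ i x * ψ j x) μ) (σ : Equiv.Perm (Fin k)) :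
    Integrable (fun x : Fin k → X => ∏ i, φ i (x i) * ψ (σ i) (x i)) (Measure.pi fun _ => μ) :=
  Integrable.fintype_prod (f := fun i x => φ i x * ψ (σ i) x) fun i => h i (σ i)

theorem integrable_prod_mul_det {φ ψ : Fin k → X → 𝕜}
    (h : ∀ i j, Integrable (fun x => φ i x * ψ j x) μ) :
    Integrable (fun x : Fin k → X => (∏ i, φ i (x i)) * (Matrix.of fun i j => ψ j (x i)).det)
      (Measure.pi fun _ => μ) := by
  simp_rw [prod_mul_det_eq_sum_perm, Matrix.of_apply]
  exact integrable_finsetSum _ fun σ _ => (integrable_prod_mul_apply_perm h σ).const_mul _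

/-- Andréief's identity. -/
theorem integral_prod_mul_det {φ ψ : Fin k → X → 𝕜}
    (h : ∀ i j, Integrable (fun x => φ i x * ψ j x) μ) :
    ∫ x, (∏ i, φ i (x i)) * (Matrix.of fun i j => ψ j (x i)).det ∂(Measure.pi fun _ => μ) =
      (Matrix.of fun i j => ∫ x, φ i x * ψ j x ∂μ).det := by
  simp_rw [prod_mul_det_eq_sum_perm, Matrix.of_apply]
  rw [integral_finsetSum _ fun σ _ => (integrable_prod_mul_apply_perm h σ).const_mul _,
    ← Matrix.det_transpose, Matrix.det_apply']
  refine Finset.sum_congr rfl fun σ _ => ?_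
  rw [integral_const_mul, integral_fintype_prod_eq_prod (f := fun i x => φ i x * ψ (σ i) x)]
  rfl

theorem integral_norm_prod_mul_det_le {φ ψ : Fin k → X → 𝕜} {p q : Fin k → ℝ}
    (h : ∀ i j, Integrable (fun x => φ i x * ψ j x) μ)
    (hpq : ∀ i j, ∫ x, ‖φ i x * ψ j x‖ ∂μ ≤ p i * q j) :
    ∫ x, ‖(∏ i, φ i (x i)) * (Matrix.of fun i j => ψ j (x i)).det‖ ∂(Measure.pi fun _ => μ) ≤
      k.factorial * ∏ i, p i * q i := by
  have hint := fun σ : Equiv.Perm (Fin k) => integrable_prod_mul_apply_perm h σ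
  have hperm : ∀ σ : Equiv.Perm (Fin k),
      ∫ x, ‖∏ i, φ i (x i) * ψ (σ i) (x i)‖ ∂(Measure.pi fun _ => μ) ≤ ∏ i, p i * q i :=
    fun σ => calc
      _ = ∏ i, ∫ x, ‖φ i x * ψ (σ i) x‖ ∂μ := by
        simp_rw [norm_prod]
        exact integral_fintype_prod_eq_prod (f := fun i x => ‖φ i x * ψ (σ i) x‖)
      _ ≤ ∏ i, p i * q (σ i) := Finset.prod_le_prod
        (fun i _ => integral_nonneg fun _ => norm_nonneg _) fun i _ => hpq i (σ i)
      _ = ∏ i, p i * q i := by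
        rw [Finset.prod_mul_distrib, Finset.prod_mul_distrib, Equiv.prod_comp σ q]
  calc _ ≤ ∫ x : Fin k → X, ∑ σ : Equiv.Perm (Fin k), ‖∏ i, φ i (x i) * ψ (σ i) (x i)‖
        ∂(Measure.pi fun _ => μ) := by
        refine integral_mono (integrable_prod_mul_det h).norm
          (integrable_finsetSum _ fun σ _ => (hint σ).norm) fun x => ?_
        dsimp only
        rw [prod_mul_det_eq_sum_perm]
        refine (norm_sum_le _ _).trans_eq (Finset.sum_congr rfl fun σ _ => ?_)
        rw [← zsmul_eq_mul, ← Units.smul_def, norm_units_zsmul]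
        rfl
    _ = ∑ σ : Equiv.Perm (Fin k),
        ∫ x, ‖∏ i, φ i (x i) * ψ (σ i) (x i)‖ ∂(Measure.pi fun _ => μ) :=
      integral_finsetSum _ fun σ _ => (hint σ).norm
    _ ≤ ∑ _σ : Equiv.Perm (Fin k), ∏ i, p i * q i := Finset.sum_le_sum fun σ _ => hperm σ
    _ = _ := by simp [Fintype.card_perm]

section Kernel

variable {ι : Type*} {α β : ι → X → 𝕜} {p q : ι → ℝ}

theorem summable_integral_norm_prod_mul_det (hpqs : Summable fun n => p n * q n)
    (hint : ∀ n m, Integrable (fun x => β n x * α m x) μ)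
    (hpq : ∀ n m, ∫ x, ‖β n x * α m x‖ ∂μ ≤ p n * q m) (k : ℕ) :
    Summable fun ν : Fin k → ι => ∫ x,
      ‖(∏ i, β (ν i) (x i)) * (Matrix.of fun i j => α (ν j) (x i)).det‖
        ∂(Measure.pi fun _ => μ) :=
  ((hasSum_prod_pow hpqs k).summable.mul_left _).of_nonneg_of_le
    (fun _ => integral_nonneg fun _ => norm_nonneg _) fun ν =>
      integral_norm_prod_mul_det_le (φ := fun i => β (ν i)) (ψ := fun i => α (ν i))
        (p := fun i => p (ν i)) (q := fun i => q (ν i))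
        (fun i j => hint (ν i) (ν j)) fun i j => hpq (ν i) (ν j)

variable {κ : X → X → 𝕜} {S : Set X}

theorem ae_hasSum_det_kernel (hS : ∀ᵐ x ∂μ, x ∈ S)
    (h : ∀ x ∈ S, ∀ y ∈ S, HasSum (fun n => β n x * α n y) (κ x y)) (k : ℕ) :
    ∀ᵐ x ∂(Measure.pi fun _ : Fin k => μ), HasSum
      (fun ν : Fin k → ι => (∏ i, β (ν i) (x i)) * (Matrix.of fun i j => α (ν j) (x i)).det)
      (Matrix.of fun i j => κ (x i) (x j)).det := by
  have hS' : ∀ᵐ x ∂(Measure.pi fun _ : Fin k => μ), ∀ i, x i ∈ S :=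
    ae_all_iff.2 fun i => (Measure.quasiMeasurePreserving_eval _ i).ae hS
  refine hS'.mono fun x hx => ?_
  have hfactor : ∀ ν : Fin k → ι, (Matrix.of fun i j => α (ν j) (x i)).det =
      (Matrix.of fun i j => α (ν i) (x j)).det := fun ν =>
    Matrix.det_transpose (Matrix.of fun i j => α (ν i) (x j))
  simp_rw [hfactor]
  exact hasSum_prod_mul_det (φ := fun i n => β n (x i)) (ψ := fun j n => α n (x j))
    (M := Matrix.of fun i j => κ (x i) (x j)) fun i j => h _ (hx i) _ (hx j)

variable [Countable ι]

theorem integrable_det_kernel (hpqs : Summable fun n => p n * q n)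
    (hint : ∀ n m, Integrable (fun x => β n x * α m x) μ)
    (hpq : ∀ n m, ∫ x, ‖β n x * α m x‖ ∂μ ≤ p n * q m) (hS : ∀ᵐ x ∂μ, x ∈ S)
    (h : ∀ x ∈ S, ∀ y ∈ S, HasSum (fun n => β n x * α n y) (κ x y)) (k : ℕ) :
    Integrable (fun x : Fin k → X => (Matrix.of fun i j => κ (x i) (x j)).det)
      (Measure.pi fun _ => μ) :=
  integrable_of_ae_hasSum (fun ν => integrable_prod_mul_det fun i j => hint (ν i) (ν j))
    (summable_integral_norm_prod_mul_det hpqs hint hpq k) (ae_hasSum_det_kernel hS h k)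

theorem integral_det_kernel (hpqs : Summable fun n => p n * q n)
    (hint : ∀ n m, Integrable (fun x => β n x * α m x) μ)
    (hpq : ∀ n m, ∫ x, ‖β n x * α m x‖ ∂μ ≤ p n * q m) (hS : ∀ᵐ x ∂μ, x ∈ S)
    (h : ∀ x ∈ S, ∀ y ∈ S, HasSum (fun n => β n x * α n y) (κ x y)) (k : ℕ) :
    ∫ x, (Matrix.of fun i j => κ (x i) (x j)).det ∂(Measure.pi fun _ : Fin k => μ) =
      ∑' ν : Fin k → ι, (Matrix.of fun i j => ∫ x, β (ν i) x * α (ν j) x ∂μ).det := by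
  have hterms := hasSum_integral_of_summable_integral_norm
    (fun ν : Fin k → ι => integrable_prod_mul_det (φ := fun i => β (ν i)) (ψ := fun i => α (ν i))
      fun i j => hint (ν i) (ν j))
    (summable_integral_norm_prod_mul_det hpqs hint hpq k)
  simp only [integral_prod_mul_det fun _ _ => hint _ _] at hterms
  rw [hterms.tsum_eq]
  exact integral_congr_ae ((ae_hasSum_det_kernel hS h k).mono fun x hx => hx.tsum_eq.symm)

end Kernel

end Measure

end Andreief

/-! ### Compressions to finite orthonormal families -/

section Compression

variable {𝕜 E κ : Type*} [RCLike 𝕜] [NormedAddCommGroup E] [InnerProductSpace 𝕜 E]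
  {v : κ → E} {k : ℕ} {ι : Type*} {a b : ι → E} {M : Matrix κ κ 𝕜}

theorem hasSum_det_submatrix
    (hM : ∀ i j, HasSum (fun n => inner 𝕜 (v i) (b n) * inner 𝕜 (a n) (v j)) (M i j))
    (t : Fin k → κ) :
    HasSum (fun ν : Fin k → ι =>
      (∏ i, inner 𝕜 (v (t i)) (b (ν i))) * (crossGram 𝕜 (a ∘ ν) (v ∘ t)).det)
      (M.submatrix t t).det :=
  hasSum_prod_mul_det (φ := fun i n => inner 𝕜 (v (t i)) (b n))
    (ψ := fun j n => inner 𝕜 (a n) (v (t j))) fun i j => hM (t i) (t j)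

variable [Fintype κ]

variable (𝕜) in
/-- The orthogonal projection `∑ᵢ ⟨vᵢ, ·⟩ vᵢ` onto the span of a finite orthonormal family `v`. -/
noncomputable def orthonormalProj (v : κ → E) (x : E) : E := ∑ i, inner 𝕜 (v i) x • v i

theorem inner_orthonormalProj (v : κ → E) (x y : E) :
    inner 𝕜 x (orthonormalProj 𝕜 v y) = ∑ i, inner 𝕜 (v i) y * inner 𝕜 x (v i) := by
  simp only [orthonormalProj, inner_sum, inner_smul_right]

theorem norm_orthonormalProj_le (hv : Orthonormal 𝕜 v) (x : E) :
    ‖orthonormalProj 𝕜 v x‖ ≤ ‖x‖ := by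
  refine le_of_sq_le_sq ?_ (norm_nonneg x)
  calc ‖orthonormalProj 𝕜 v x‖ ^ 2 = ∑ i, ‖inner 𝕜 (v i) x‖ ^ 2 := by
        rw [← inner_self_eq_norm_sq (𝕜 := 𝕜), orthonormalProj, hv.inner_sum, map_sum]
        exact Finset.sum_congr rfl fun i _ => by
          rw [RCLike.conj_mul, ← RCLike.ofReal_pow, RCLike.ofReal_re]
    _ ≤ ‖x‖ ^ 2 := hv.sum_inner_products_le x

theorem sum_prod_mul_det_crossGram (v : κ → E) (a b : Fin k → E) :
    ∑ t : Fin k → κ, (∏ i, inner 𝕜 (v (t i)) (b i)) * (crossGram 𝕜 a (v ∘ t)).det =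
      (crossGram 𝕜 a (orthonormalProj 𝕜 v ∘ b)).det := by
  have := sum_prod_mul_det (fun i x => inner 𝕜 (v x) (b i)) fun j x => inner 𝕜 (a j) (v x)
  simp only [← inner_orthonormalProj] at this
  rw [← Matrix.det_transpose]
  refine (Finset.sum_congr rfl fun t _ => ?_).trans this
  rw [← Matrix.det_transpose]
  rfl

theorem sum_norm_det_crossGram_sq_le (hv : Orthonormal 𝕜 v) (a : Fin k → E) :
    ∑ t : Fin k → κ, ‖(crossGram 𝕜 a (v ∘ t)).det‖ ^ 2 ≤ k.factorial * (∏ i, ‖a i‖) ^ 2 := by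
  have hconj : ∀ t : Fin k → κ, (Matrix.of fun i j => inner 𝕜 (v (t j)) (a i)).det =
      star (crossGram 𝕜 a (v ∘ t)).det := fun t => by
    rw [← Matrix.det_conjTranspose, ← Matrix.det_transpose]
    congr 1
    ext i j
    exact (inner_conj_symm _ _).symm
  have htranspose : ∀ t : Fin k → κ, (Matrix.of fun i j => inner 𝕜 (a j) (v (t i))).det =
      (crossGram 𝕜 a (v ∘ t)).det := fun t => Matrix.det_transpose (crossGram 𝕜 a (v ∘ t))
  have hsum : ((∑ t : Fin k → κ, ‖(crossGram 𝕜 a (v ∘ t)).det‖ ^ 2 : ℝ) : 𝕜) =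
      k.factorial * (crossGram 𝕜 a (orthonormalProj 𝕜 v ∘ a)).det := by
    have := sum_det_mul_det (fun i x => inner 𝕜 (v x) (a i)) fun j x => inner 𝕜 (a j) (v x)
    simp only [hconj, htranspose, ← inner_orthonormalProj] at this
    rw [← Matrix.det_transpose (crossGram 𝕜 a _), RCLike.ofReal_sum]
    simp only [RCLike.star_def, RCLike.conj_mul, ← RCLike.ofReal_pow] at this
    exact this
  have hnorm := congrArg norm hsum
  rw [RCLike.norm_ofReal, abs_of_nonneg (Finset.sum_nonneg fun _ _ => by positivity), norm_mul,
    RCLike.norm_natCast] at hnorm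
  rw [hnorm, sq]
  gcongr
  refine (norm_det_crossGram_le _ _).trans (mul_le_mul_of_nonneg_left ?_ (by positivity))
  exact Finset.prod_le_prod (fun _ _ => norm_nonneg _) fun i _ => norm_orthonormalProj_le hv (a i)

theorem sum_prod_norm_inner_sq_le (hv : Orthonormal 𝕜 v) (b : Fin k → E) :
    ∑ t : Fin k → κ, (∏ i, ‖inner 𝕜 (v (t i)) (b i)‖) ^ 2 ≤ (∏ i, ‖b i‖) ^ 2 := by
  simp only [← Finset.prod_pow]
  rw [← Fintype.piFinset_univ,
    ← Finset.prod_univ_sum (fun _ => Finset.univ) fun i x => ‖inner 𝕜 (v x) (b i)‖ ^ 2]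
  exact Finset.prod_le_prod (fun i _ => Finset.sum_nonneg fun _ _ => by positivity)
    fun i _ => hv.sum_inner_products_le (b i)

theorem sum_norm_prod_mul_det_crossGram_le (hv : Orthonormal 𝕜 v) (a b : Fin k → E) :
    ∑ t : Fin k → κ, ‖(∏ i, inner 𝕜 (v (t i)) (b i)) * (crossGram 𝕜 a (v ∘ t)).det‖ ≤
      √k.factorial * ∏ i, ‖a i‖ * ‖b i‖ := by
  simp only [norm_mul, norm_prod]
  calc _ ≤ √(∑ t : Fin k → κ, (∏ i, ‖inner 𝕜 (v (t i)) (b i)‖) ^ 2) *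
        √(∑ t : Fin k → κ, ‖(crossGram 𝕜 a (v ∘ t)).det‖ ^ 2) := Real.sum_mul_le_sqrt_mul_sqrt _ _ _
    _ ≤ √((∏ i, ‖b i‖) ^ 2) * √(k.factorial * (∏ i, ‖a i‖) ^ 2) := by
      gcongr
      exacts [sum_prod_norm_inner_sq_le hv b, sum_norm_det_crossGram_sq_le hv a]
    _ = _ := by
      rw [Real.sqrt_mul (by positivity), Real.sqrt_sq (by positivity),
        Real.sqrt_sq (by positivity), Finset.prod_mul_distrib]
      ring

theorem sum_det_submatrix
    (hM : ∀ i j, HasSum (fun n => inner 𝕜 (v i) (b n) * inner 𝕜 (a n) (v j)) (M i j)) (k : ℕ) :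
    ∑ t : Fin k → κ, (M.submatrix t t).det =
      ∑' ν : Fin k → ι, (crossGram 𝕜 (a ∘ ν) (orthonormalProj 𝕜 v ∘ b ∘ ν)).det := by
  rw [← (hasSum_sum fun t _ => hasSum_det_submatrix hM t).tsum_eq]
  exact tsum_congr fun ν => sum_prod_mul_det_crossGram v (a ∘ ν) (b ∘ ν)

/-- Bounding each minor separately would lose the factor `1 / √k!`, which is what makes the sum over
`k` of all principal minors converge. -/
theorem sum_norm_det_submatrix_le (hv : Orthonormal 𝕜 v)
    (hM : ∀ i j, HasSum (fun n => inner 𝕜 (v i) (b n) * inner 𝕜 (a n) (v j)) (M i j))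
    (hs : Summable fun n => ‖a n‖ * ‖b n‖) (k : ℕ) :
    ∑ t : Fin k → κ, ‖(M.submatrix t t).det‖ ≤ √k.factorial * (∑' n, ‖a n‖ * ‖b n‖) ^ k := by
  have hsum := fun t : Fin k → κ => (hasSum_det_submatrix hM t).summable.norm
  have hprod := hasSum_prod_pow hs k
  calc _ ≤ ∑ t : Fin k → κ, ∑' ν : Fin k → ι,
        ‖(∏ i, inner 𝕜 (v (t i)) (b (ν i))) * (crossGram 𝕜 (a ∘ ν) (v ∘ t)).det‖ :=
        Finset.sum_le_sum fun t _ => by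
          rw [← (hasSum_det_submatrix hM t).tsum_eq]
          exact norm_tsum_le_tsum_norm (hsum t)
    _ = ∑' ν : Fin k → ι, ∑ t : Fin k → κ,
        ‖(∏ i, inner 𝕜 (v (t i)) (b (ν i))) * (crossGram 𝕜 (a ∘ ν) (v ∘ t)).det‖ :=
        (Summable.tsum_finsetSum fun t _ => hsum t).symm
    _ ≤ ∑' ν : Fin k → ι, √k.factorial * ∏ i, ‖a (ν i)‖ * ‖b (ν i)‖ :=
        Summable.tsum_le_tsum (fun ν => sum_norm_prod_mul_det_crossGram_le hv (a ∘ ν) (b ∘ ν))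
          (summable_sum fun t _ => hsum t) (hprod.summable.mul_left _)
    _ = _ := by rw [tsum_mul_left, hprod.tsum_eq]

end Compression

theorem summable_pow_div_sqrt_factorial (x : ℝ) :
    Summable fun k : ℕ => x ^ k / √(k.factorial : ℝ) := by
  rcases eq_or_ne x 0 with rfl | hx
  · exact summable_of_ne_finset_zero (s := {0}) fun k hk => by
      rw [zero_pow (Finset.notMem_singleton.1 hk), zero_div]
  have hpos : ∀ k : ℕ, (0 : ℝ) < √(k.factorial : ℝ) := fun k => by positivity
  refine summable_of_ratio_test_tendsto_lt_one zero_lt_one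
    (.of_forall fun k => div_ne_zero (pow_ne_zero k hx) (hpos k).ne') ?_
  have hratio : ∀ k : ℕ, |x| / √((k + 1 : ℕ) : ℝ) =
      ‖x ^ (k + 1) / √((k + 1).factorial : ℝ)‖ / ‖x ^ k / √(k.factorial : ℝ)‖ := fun k => by
    have := (hpos k).ne'
    rw [Nat.factorial_succ, Nat.cast_mul, Real.sqrt_mul (Nat.cast_nonneg _)]
    simp only [norm_div, norm_mul, norm_pow, Real.norm_eq_abs, abs_of_nonneg (Real.sqrt_nonneg _)]
    field_simp
    rw [pow_succ']
  refine Tendsto.congr hratio (tendsto_const_nhds.div_atTop ?_)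
  exact Real.tendsto_sqrt_atTop.comp
    (tendsto_natCast_atTop_atTop.comp (tendsto_add_atTop_nat 1))

/-! ### The Fredholm determinant of a nuclear operator -/

section Nuclear

variable {𝕜 E ι : Type*} [RCLike 𝕜] [NormedAddCommGroup E] [InnerProductSpace 𝕜 E]

/-- The expansion `T = ∑ₙ ⟨aₙ, ·⟩ bₙ` of an operator into operators of rank one; the series
converges in the strong operator topology. -/
def HasRankOneExpansion (a b : ι → E) (T : E →L[𝕜] E) : Prop :=
  ∀ x, HasSum (fun n => inner 𝕜 (a n) x • b n) (T x)

namespace HasRankOneExpansion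

variable {a b : ι → E} {T : E →L[𝕜] E}

theorem hasSum_inner (hT : HasRankOneExpansion a b T) (x y : E) :
    HasSum (fun n => inner 𝕜 x (b n) * inner 𝕜 (a n) y) (inner 𝕜 x (T y)) := by
  simpa only [innerSL_apply_apply, inner_smul_right, mul_comm] using (hT y).mapL (innerSL 𝕜 x)

theorem comp_comp [CompleteSpace E] (hT : HasRankOneExpansion a b T) (R S : E →L[𝕜] E) :
    HasRankOneExpansion (fun n => S.adjoint (a n)) (fun n => R (b n)) (R ∘L T ∘L S) := fun x => by
  simpa only [map_smul, ContinuousLinearMap.adjoint_inner_left, ContinuousLinearMap.comp_apply]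
    using (hT (S x)).mapL R

theorem add {ι' : Type*} {a' b' : ι' → E} {T' : E →L[𝕜] E} (hT : HasRankOneExpansion a b T)
    (hT' : HasRankOneExpansion a' b' T') :
    HasRankOneExpansion (Sum.elim a a') (Sum.elim b b') (T + T') := fun x =>
  HasSum.sum (f := fun n => inner 𝕜 (Sum.elim a a' n) x • Sum.elim b b' n) (hT x) (hT' x)

end HasRankOneExpansion

variable (𝕜) in
/-- The coefficient `(-1)ᵏ tr (Λᵏ T)` of the Fredholm determinant of `T = ∑ₙ ⟨aₙ, ·⟩ bₙ`. -/
noncomputable def fredholmCoeff (a b : ι → E) (k : ℕ) : 𝕜 :=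
  (-1) ^ k / (k.factorial : 𝕜) * ∑' ν : Fin k → ι, (crossGram 𝕜 (a ∘ ν) (b ∘ ν)).det

variable (𝕜) in
/-- The Fredholm determinant `det (1 - T)` of the nuclear operator `T = ∑ₙ ⟨aₙ, ·⟩ bₙ`. -/
noncomputable def fredholmSum (a b : ι → E) : 𝕜 := ∑' k, fredholmCoeff 𝕜 a b k

theorem fredholmSum_congr {a b a' b' : ι → E}
    (h : ∀ n m, inner 𝕜 (a n) (b m) = inner 𝕜 (a' n) (b' m)) :
    fredholmSum 𝕜 a b = fredholmSum 𝕜 a' b' := by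
  simp only [fredholmSum, fredholmCoeff, crossGram, Function.comp_apply, h]

theorem norm_det_crossGram_comp_le {a b : ι → E} {q : ι → ℝ} (hb : ∀ n, ‖b n‖ ≤ q n) {k : ℕ}
    (ν : Fin k → ι) : ‖(crossGram 𝕜 (a ∘ ν) (b ∘ ν)).det‖ ≤ ∏ i, ‖a (ν i)‖ * q (ν i) := by
  refine (norm_det_crossGram_le _ _).trans ?_
  rw [← Finset.prod_mul_distrib]
  exact Finset.prod_le_prod (fun i _ => by positivity)
    fun i _ => mul_le_mul_of_nonneg_left (hb _) (norm_nonneg _)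

theorem norm_fredholmCoeff_le {a b : ι → E} {q : ι → ℝ} (hq : Summable fun n => ‖a n‖ * q n)
    (hb : ∀ n, ‖b n‖ ≤ q n) (k : ℕ) :
    ‖fredholmCoeff 𝕜 a b k‖ ≤ (∑' n, ‖a n‖ * q n) ^ k / k.factorial := by
  have hk : ‖(-1) ^ k / (k.factorial : 𝕜)‖ = (k.factorial : ℝ)⁻¹ := by simp
  rw [fredholmCoeff, norm_mul, hk, div_eq_inv_mul]
  gcongr
  exact tsum_of_norm_bounded (hasSum_prod_pow hq k) (norm_det_crossGram_comp_le hb)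

theorem summable_fredholmCoeff {a b : ι → E} (hs : Summable fun n => ‖a n‖ * ‖b n‖) :
    Summable (fredholmCoeff 𝕜 a b) :=
  .of_norm_bounded (Real.summable_pow_div_factorial _) (norm_fredholmCoeff_le hs fun _ => le_rfl)

section Limit

variable {γ : Type*} {l : Filter γ} {a b₀ : ι → E} {b : γ → ι → E} {q : ι → ℝ}

theorem tendsto_fredholmSum (hq : Summable fun n => ‖a n‖ * q n) (hb : ∀ s n, ‖b s n‖ ≤ q n)
    (h : ∀ n m, Tendsto (fun s => inner 𝕜 (a n) (b s m)) l (𝓝 (inner 𝕜 (a n) (b₀ m)))) :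
    Tendsto (fun s => fredholmSum 𝕜 a (b s)) l (𝓝 (fredholmSum 𝕜 a b₀)) := by
  refine tendsto_tsum_of_dominated_convergence (Real.summable_pow_div_factorial _) (fun k => ?_)
    (.of_forall fun s k => norm_fredholmCoeff_le hq (hb s) k)
  refine Tendsto.const_mul _ (tendsto_tsum_of_dominated_convergence (hasSum_prod_pow hq k).summable
    (fun ν => ?_) (.of_forall fun s ν => norm_det_crossGram_comp_le (hb s) ν))
  have hdet : Continuous fun M : Matrix (Fin k) (Fin k) 𝕜 => M.det := by fun_prop
  exact (hdet.tendsto _).comp (tendsto_pi_nhds.2 fun i => tendsto_pi_nhds.2 fun j => h _ _)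

theorem fredholmSum_comp_of_eq_zero {κ : Type*} {b : ι → E} {j : κ → ι}
    (hj : Function.Injective j) (hb : ∀ n ∉ range j, b n = 0) :
    fredholmSum 𝕜 (a ∘ j) (b ∘ j) = fredholmSum 𝕜 a b := by
  refine tsum_congr fun k => ?_
  rw [fredholmCoeff, fredholmCoeff]
  congr 1
  refine hj.comp_left.tsum_eq (f := fun ν : Fin k → ι => (crossGram 𝕜 (a ∘ ν) (b ∘ ν)).det)
    fun ν hν => ?_
  have hmem : ∀ i, ν i ∈ range j := by
    contrapose! hν
    obtain ⟨i, hi⟩ := hν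
    refine Function.notMem_support.2 (Matrix.det_eq_zero_of_column_eq_zero i fun i' => ?_)
    rw [crossGram, Matrix.of_apply, Function.comp_apply, Function.comp_apply, hb _ hi,
      inner_zero_right]
  choose ν' hν' using hmem
  exact ⟨ν', funext hν'⟩

theorem fredholmSum_eq_det {κ : Type*} [Fintype κ] [DecidableEq κ] (a b : κ → E) :
    fredholmSum 𝕜 a b = (1 - crossGram 𝕜 a b).det := by
  rw [← (hasSum_det_one_sub (crossGram 𝕜 a b)).tsum_eq]
  refine tsum_congr fun k => ?_
  rw [fredholmCoeff, tsum_fintype]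
  rfl

theorem tendsto_det_one_sub_crossGram {κ : γ → Type*} [∀ s, Fintype (κ s)]
    [∀ s, DecidableEq (κ s)] {j : ∀ s, κ s → ι} (hj : ∀ s, Function.Injective (j s))
    (hrange : ∀ n, ∀ᶠ s in l, n ∈ range (j s)) (hq : Summable fun n => ‖a n‖ * q n)
    (hb : ∀ s n, ‖b s n‖ ≤ q n)
    (h : ∀ n m, Tendsto (fun s => inner 𝕜 (a n) (b s m)) l (𝓝 (inner 𝕜 (a n) (b₀ m)))) :
    Tendsto (fun s => (1 - crossGram 𝕜 (a ∘ j s) (b s ∘ j s)).det) l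
      (𝓝 (fredholmSum 𝕜 a b₀)) := by
  have htrunc : ∀ s, (1 - crossGram 𝕜 (a ∘ j s) (b s ∘ j s)).det =
      fredholmSum 𝕜 a ((range (j s)).indicator (b s)) := fun s => by
    rw [← fredholmSum_eq_det, ← fredholmSum_comp_of_eq_zero (hj s)
      fun n hn => indicator_of_notMem hn (b s)]
    refine fredholmSum_congr fun n m => ?_
    simp only [Function.comp_apply, indicator_of_mem (mem_range_self _)]
  simp only [htrunc]
  refine tendsto_fredholmSum hq (fun s n => (norm_indicator_le_norm_self _ _).trans (hb s n))
    fun n m => (h n m).congr' ((hrange m).mono fun s hs => ?_)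
  dsimp only
  rw [indicator_of_mem hs]

end Limit

theorem det_one_sub_crossGram_sumElim {κ : Type*} [Fintype κ] [DecidableEq κ] {a b a' b' : κ → E}
    (h : ∀ n m, inner 𝕜 (a n) (b m) = 0) (h' : ∀ n m, inner 𝕜 (a' n) (b' m) = 0) :
    (1 - crossGram 𝕜 (Sum.elim a a') (Sum.elim b b')).det =
      (1 - crossGram 𝕜 a fun m => ∑ n, inner 𝕜 (a' n) (b m) • b' n).det := by
  have hblock : 1 - crossGram 𝕜 (Sum.elim a a') (Sum.elim b b') =
      Matrix.fromBlocks 1 (-crossGram 𝕜 a b') (-crossGram 𝕜 a' b) 1 := by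
    ext (i | i) (j | j) <;> simp [crossGram, h, h', Matrix.one_apply]
  rw [hblock, Matrix.det_fromBlocks_one₂₂, neg_mul_neg]
  congr 2
  ext i j
  simp only [crossGram, Matrix.mul_apply, Matrix.of_apply, inner_sum, inner_smul_right, mul_comm]

theorem norm_sum_inner_smul_le {a b : ι → E} (hs : Summable fun n => ‖a n‖ * ‖b n‖) (S : Finset ι)
    (x : E) : ‖∑ n ∈ S, inner 𝕜 (a n) x • b n‖ ≤ (∑' n, ‖a n‖ * ‖b n‖) * ‖x‖ := calc
  _ ≤ ∑ n ∈ S, ‖a n‖ * ‖b n‖ * ‖x‖ := (norm_sum_le _ _).trans <|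
    Finset.sum_le_sum fun n _ => by
      rw [norm_smul, mul_right_comm]
      exact mul_le_mul_of_nonneg_right (norm_inner_le_norm _ _) (norm_nonneg _)
  _ ≤ _ := by
    rw [← Finset.sum_mul]
    exact mul_le_mul_of_nonneg_right (hs.sum_le_tsum S fun n _ => by positivity) (norm_nonneg _)

theorem summable_norm_mul_norm_sumElim {ι' : Type*} {a b : ι → E} {a' b' : ι' → E}
    (hs : Summable fun n => ‖a n‖ * ‖b n‖) (hs' : Summable fun n => ‖a' n‖ * ‖b' n‖) :
    Summable fun n => ‖Sum.elim a a' n‖ * ‖Sum.elim b b' n‖ :=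
  Summable.sum _ hs hs'

theorem fredholmSum_sumElim_of_inner_eq_zero {a b a' b' : ι → E} {T : E →L[𝕜] E}
    (hT : HasRankOneExpansion a' b' T) (h : ∀ n m, inner 𝕜 (a n) (b m) = 0)
    (h' : ∀ n m, inner 𝕜 (a' n) (b' m) = 0) (hs : Summable fun n => ‖a n‖ * ‖b n‖)
    (hs' : Summable fun n => ‖a' n‖ * ‖b' n‖) :
    fredholmSum 𝕜 (Sum.elim a a') (Sum.elim b b') = fredholmSum 𝕜 a fun n => T (b n) := by
  classical
  have hmem : ∀ n : ι, ∀ᶠ S : Finset ι in atTop, n ∈ S := fun n =>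
    (eventually_ge_atTop {n}).mono fun S hS => hS (Finset.mem_singleton_self n)
  let j : ∀ S : Finset ι, S ⊕ S → ι ⊕ ι := fun S => Sum.map (↑) (↑)
  have hj : ∀ n, ∀ᶠ S : Finset ι in atTop, n ∈ range (j S) := by
    rintro (n | n)
    exacts [(hmem n).mono fun S hS => ⟨.inl ⟨n, hS⟩, rfl⟩,
      (hmem n).mono fun S hS => ⟨.inr ⟨n, hS⟩, rfl⟩]
  have hlim := tendsto_det_one_sub_crossGram (𝕜 := 𝕜) (b := fun _ => Sum.elim b b')
    (fun S => Subtype.val_injective.sumMap Subtype.val_injective) hj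
    (summable_norm_mul_norm_sumElim hs hs') (fun _ _ => le_rfl)
    fun n m => tendsto_const_nhds (x := inner 𝕜 (Sum.elim a a' n) (Sum.elim b b' m))
  have hlim' := tendsto_det_one_sub_crossGram (𝕜 := 𝕜) (a := a) (b₀ := fun n => T (b n))
    (b := fun S m => ∑ n ∈ S, inner 𝕜 (a' n) (b m) • b' n) (j := fun S : Finset ι => ((↑) : S → ι))
    (fun S => Subtype.val_injective) (fun n => (hmem n).mono fun S hS => ⟨⟨n, hS⟩, rfl⟩)
    (by simpa only [mul_left_comm] using hs.mul_left (∑' n, ‖a' n‖ * ‖b' n‖))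
    (fun S m => norm_sum_inner_smul_le hs' S (b m))
    fun n m => tendsto_const_nhds.inner (hT (b m))
  refine tendsto_nhds_unique hlim (hlim'.congr fun S => ?_)
  rw [Sum.elim_comp_map, Sum.elim_comp_map, det_one_sub_crossGram_sumElim (a := a ∘ Subtype.val)
    (a' := a' ∘ Subtype.val) (fun n m => h n m) fun n m => h' n m]
  congr 2
  ext n m
  simp only [crossGram, Matrix.of_apply, Function.comp_apply]
  rw [Finset.sum_coe_sort S fun n => inner 𝕜 (a' n) (b m) • b' n]

end Nuclear

/-! ### Compressions of a nuclear operator -/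

section MinorBound

variable {𝕜 E κ ι : Type*} [RCLike 𝕜] [NormedAddCommGroup E] [InnerProductSpace 𝕜 E] [Fintype κ]
  [DecidableEq κ] {v : κ → E} {a b : ι → E} {M : Matrix κ κ 𝕜}

theorem det_one_sub_eq_fredholmSum
    (hM : ∀ i j, HasSum (fun n => inner 𝕜 (v i) (b n) * inner 𝕜 (a n) (v j)) (M i j)) :
    (1 - M).det = fredholmSum 𝕜 a (orthonormalProj 𝕜 v ∘ b) := by
  rw [← (hasSum_det_one_sub M).tsum_eq]
  exact tsum_congr fun k => by rw [fredholmCoeff, sum_det_submatrix hM]; rfl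

theorem sum_powersetCard_norm_minors_le (hv : Orthonormal 𝕜 v)
    (hM : ∀ i j, HasSum (fun n => inner 𝕜 (v i) (b n) * inner 𝕜 (a n) (v j)) (M i j))
    (hs : Summable fun n => ‖a n‖ * ‖b n‖) (k : ℕ) :
    ∑ s ∈ Finset.powersetCard k (Finset.univ : Finset κ),
        ‖(M.submatrix ((↑) : s → κ) (↑)).det‖ ≤
      (∑' n, ‖a n‖ * ‖b n‖) ^ k / √(k.factorial : ℝ) := by
  have hk : 0 < √(k.factorial : ℝ) := by positivity
  have hminors := factorial_nsmul_sum_minors M norm_zero k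
  rw [nsmul_eq_mul, ← Real.mul_self_sqrt (Nat.cast_nonneg k.factorial), mul_assoc] at hminors
  rw [le_div_iff₀' hk]
  exact le_of_mul_le_mul_left (hminors.trans_le (sum_norm_det_submatrix_le hv hM hs k)) hk

theorem sum_norm_minors_le (hv : Orthonormal 𝕜 v)
    (hM : ∀ i j, HasSum (fun n => inner 𝕜 (v i) (b n) * inner 𝕜 (a n) (v j)) (M i j))
    (hs : Summable fun n => ‖a n‖ * ‖b n‖) :
    ∑ s : Finset κ, ‖(M.submatrix ((↑) : s → κ) (↑)).det‖ ≤
      ∑' k : ℕ, (∑' n, ‖a n‖ * ‖b n‖) ^ k / √(k.factorial : ℝ) := by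
  have hc : 0 ≤ ∑' n, ‖a n‖ * ‖b n‖ := tsum_nonneg fun n => by positivity
  rw [← Finset.powerset_univ, Finset.sum_powerset]
  exact (Finset.sum_le_sum fun k _ => sum_powersetCard_norm_minors_le hv hM hs k).trans
    ((summable_pow_div_sqrt_factorial _).sum_le_tsum _ fun k _ =>
      div_nonneg (pow_nonneg hc k) (Real.sqrt_nonneg _))

end MinorBound

section Compression

variable {𝕜 E ι κ : Type*} [RCLike 𝕜] [NormedAddCommGroup E] [InnerProductSpace 𝕜 E]
  {a b : ι → E} {T : E →L[𝕜] E}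

theorem tendsto_inner_orthonormalProj (e : HilbertBasis κ 𝕜 E) (x y : E) :
    Tendsto (fun S : Finset κ => inner 𝕜 x (orthonormalProj 𝕜 (fun i : S => e i) y)) atTop
      (𝓝 (inner 𝕜 x y)) := by
  refine (e.hasSum_inner_mul_inner x y).congr fun S => ?_
  rw [inner_orthonormalProj, Finset.sum_coe_sort S fun i => inner 𝕜 (e i) y * inner 𝕜 x (e i)]
  exact Finset.sum_congr rfl fun i _ => mul_comm _ _

namespace HasRankOneExpansion

theorem tendsto_det_compression [DecidableEq κ] (hT : HasRankOneExpansion a b T)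
    (hs : Summable fun n => ‖a n‖ * ‖b n‖) (e : HilbertBasis κ 𝕜 E) :
    Tendsto (fun S : Finset κ =>
        (1 - crossGram 𝕜 (fun i : S => e i) fun i : S => T (e i)).det) atTop
      (𝓝 (fredholmSum 𝕜 a b)) := by
  refine (tendsto_fredholmSum hs (fun (S : Finset κ) n => norm_orthonormalProj_le
    (e.orthonormal.comp ((↑) : S → κ) Subtype.val_injective) (b n))
    fun n m => tendsto_inner_orthonormalProj e (a n) (b m)).congr fun S => ?_
  exact (det_one_sub_eq_fredholmSum (v := fun i : S => e i)
    fun i j => hT.hasSum_inner (e i) (e j)).symm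

theorem fredholmSum_eq [CompleteSpace E] {ι' : Type*} {a' b' : ι' → E}
    (hT : HasRankOneExpansion a b T) (hs : Summable fun n => ‖a n‖ * ‖b n‖)
    (hT' : HasRankOneExpansion a' b' T) (hs' : Summable fun n => ‖a' n‖ * ‖b' n‖) :
    fredholmSum 𝕜 a b = fredholmSum 𝕜 a' b' := by
  classical
  obtain ⟨w, e, -⟩ := exists_hilbertBasis 𝕜 E
  exact tendsto_nhds_unique (hT.tendsto_det_compression hs e) (hT'.tendsto_det_compression hs' e)

end HasRankOneExpansion

theorem add_corners_eq_of_offDiagonal {P : E →L[𝕜] E} (hP₁ : P ∘L T ∘L P = 0)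
    (hP₂ : (1 - P) ∘L T ∘L (1 - P) = 0) :
    (1 - P) ∘L T ∘L P + P ∘L T ∘L (1 - P) = T := by
  have hsum : (1 - P) ∘L T ∘L P + P ∘L T ∘L (1 - P) + P ∘L T ∘L P +
      (1 - P) ∘L T ∘L (1 - P) = T := by
    ext x
    simp only [add_apply, ContinuousLinearMap.comp_apply, sub_apply, one_apply_eq_self, map_sub]
    abel
  rwa [hP₁, hP₂, add_zero, add_zero] at hsum

theorem inner_apply_one_sub_apply [CompleteSpace E] {P : E →L[𝕜] E} (hP : IsStarProjection P)
    (x y : E) : inner 𝕜 (P x) ((1 - P) y) = 0 := by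
  have hadj : P.adjoint = P := hP.isSelfAdjoint
  rw [← ContinuousLinearMap.adjoint_inner_right, hadj, ← mul_apply_eq_comp, mul_sub, mul_one,
    hP.isIdempotentElem.eq, sub_self, zero_apply, inner_zero_right]

/-- The off-diagonal blocks `(1 - P) T P` and `P T (1 - P)` have expansions with vanishing Gram
matrices, so the determinant of their sum is that of a Schur complement. -/
theorem HasRankOneExpansion.fredholmSum_eq_of_offDiagonal [CompleteSpace E] {P : E →L[𝕜] E}
    (hP : IsStarProjection P) (hT : HasRankOneExpansion a b T)
    (hs : Summable fun n => ‖a n‖ * ‖b n‖) (hP₁ : P ∘L T ∘L P = 0)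
    (hP₂ : (1 - P) ∘L T ∘L (1 - P) = 0) :
    fredholmSum 𝕜 a b = fredholmSum 𝕜 a fun n => P (T (b n)) := by
  have hadj : P.adjoint = P := hP.isSelfAdjoint
  have hadj' : (1 - P).adjoint = 1 - P := hP.one_sub.isSelfAdjoint
  have horth := inner_apply_one_sub_apply hP
  have hidem : ∀ x, P (P x) = P x := fun x => congr($(hP.isIdempotentElem.eq) x)
  have hPT : ∀ x, P (T ((1 - P) x)) = P (T x) := fun x => by
    have hzero : P (T (P x)) = 0 := congr($hP₁ x)
    rw [sub_apply, one_apply_eq_self, map_sub, map_sub, hzero, sub_zero]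
  have hQP := hT.comp_comp (1 - P) P
  have hPQ := hT.comp_comp P (1 - P)
  rw [hadj] at hQP
  rw [hadj'] at hPQ
  have hbound : ∀ R S : E →L[𝕜] E, Summable fun n => ‖R (a n)‖ * ‖S (b n)‖ := fun R S =>
    (hs.mul_left (‖R‖ * ‖S‖)).of_nonneg_of_le (fun n => by positivity) fun n =>
      (mul_le_mul (R.le_opNorm _) (S.le_opNorm _) (by positivity) (by positivity)).trans_eq
        (mul_mul_mul_comm _ _ _ _)
  have hT' := hQP.add hPQ
  rw [add_corners_eq_of_offDiagonal hP₁ hP₂] at hT'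
  rw [hT.fredholmSum_eq hs hT' (summable_norm_mul_norm_sumElim (hbound P (1 - P))
      (hbound (1 - P) P)),
    fredholmSum_sumElim_of_inner_eq_zero hPQ (fun n m => horth (a n) (b m))
      (fun n m => inner_eq_zero_symm.1 (horth (b m) (a n))) (hbound P (1 - P)) (hbound (1 - P) P)]
  refine fredholmSum_congr fun n m => ?_
  rw [← ContinuousLinearMap.adjoint_inner_right, hadj]
  exact congrArg _ ((hidem _).trans ((hPT _).trans (hPT _)))

end Compression

section FredholmDet

variable {E : Type uE} [NormedAddCommGroup E] [InnerProductSpace ℂ E] {ι κ : Type*}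
  {a b : ι → E} {T : E →L[ℂ] E}

theorem sum_powerset_eq_sum_map {M : Type*} [AddCommMonoid M] (S : Finset κ) (φ : Finset κ → M) :
    ∑ s ∈ S.powerset, φ s = ∑ s : Finset S, φ (s.map (.subtype (· ∈ S))) := by
  classical
  refine Finset.sum_bij' (fun s _ => s.subtype (· ∈ S)) (fun s _ => s.map (.subtype (· ∈ S)))
    (fun s _ => Finset.mem_univ _) (fun s _ => Finset.mem_powerset.2 (Finset.map_subtype_subset s))
    (fun s hs => ?_) (fun s _ => ?_) fun s hs => ?_
  · exact Finset.subtype_map_of_mem fun x hx => Finset.mem_powerset.1 hs hx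
  · ext x
    simp
  · rw [Finset.subtype_map_of_mem fun x hx => Finset.mem_powerset.1 hs hx]

variable {κ : Type uE}

theorem principalMinor_map_subtype (e : HilbertBasis κ ℂ E) (T : E →L[ℂ] E) {S : Finset κ}
    [DecidableEq S] (s : Finset S) :
    principalMinor e T (s.map (.subtype (· ∈ S))) =
      ((crossGram ℂ (fun i : S => e i) fun i : S => T (e i)).submatrix
        ((↑) : s → S) (↑)).det := by
  classical
  let φ : s ≃ s.map (.subtype (· ∈ S)) := Equiv.ofBijective
    (fun i => ⟨i, Finset.mem_map_of_mem (.subtype (· ∈ S)) i.2⟩)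
    ⟨fun i j hij => Subtype.ext (Subtype.ext (Subtype.mk.inj hij)), fun ⟨x, hx⟩ => by
      obtain ⟨i, hi, rfl⟩ := Finset.mem_map.1 hx
      exact ⟨⟨i, hi⟩, rfl⟩⟩
  rw [principalMinor, ← Matrix.det_submatrix_equiv_self φ]
  rfl

theorem HasRankOneExpansion.sum_powerset_norm_principalMinor_le (hT : HasRankOneExpansion a b T)
    (hs : Summable fun n => ‖a n‖ * ‖b n‖) (e : HilbertBasis κ ℂ E) (S : Finset κ) :
    ∑ s ∈ S.powerset, ‖principalMinor e T s‖ ≤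
      ∑' k : ℕ, (∑' n, ‖a n‖ * ‖b n‖) ^ k / √(k.factorial : ℝ) := by
  classical
  rw [sum_powerset_eq_sum_map]
  simp only [principalMinor_map_subtype]
  exact sum_norm_minors_le (e.orthonormal.comp ((↑) : S → κ) Subtype.val_injective)
    (fun i j => hT.hasSum_inner (e i) (e j)) hs

theorem HasRankOneExpansion.summable_principalMinor (hT : HasRankOneExpansion a b T)
    (hs : Summable fun n => ‖a n‖ * ‖b n‖) (e : HilbertBasis κ ℂ E) :
    Summable fun s : Finset κ => (-1 : ℂ) ^ s.card * principalMinor e T s := by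
  classical
  refine .of_norm (summable_of_sum_le
    (c := ∑' k : ℕ, (∑' n, ‖a n‖ * ‖b n‖) ^ k / √(k.factorial : ℝ))
    (fun _ => norm_nonneg _) fun U => ?_)
  simp only [norm_mul, norm_pow, norm_neg, norm_one, one_pow, one_mul]
  have hU : U ⊆ (U.sup id).powerset := fun s hs' =>
    Finset.mem_powerset.2 (Finset.le_sup (f := id) hs')
  exact (Finset.sum_le_sum_of_subset_of_nonneg hU fun _ _ _ => norm_nonneg _).trans
    (hT.sum_powerset_norm_principalMinor_le hs e _)

theorem sum_powerset_principalMinor [DecidableEq κ] (e : HilbertBasis κ ℂ E) (T : E →L[ℂ] E)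
    (S : Finset κ) :
    ∑ s ∈ S.powerset, (-1 : ℂ) ^ s.card * principalMinor e T s =
      (1 - crossGram ℂ (fun i : S => e i) fun i : S => T (e i)).det := by
  rw [sum_powerset_eq_sum_map, det_one_sub_eq_sum_minors]
  simp only [Finset.card_map, principalMinor_map_subtype]

theorem HasRankOneExpansion.hasFredholmDet (hT : HasRankOneExpansion a b T)
    (hs : Summable fun n => ‖a n‖ * ‖b n‖) : HasFredholmDet T (fredholmSum ℂ a b) := by
  classical
  intro κ e
  have hpowerset : Tendsto (Finset.powerset : Finset κ → _) atTop atTop :=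
    tendsto_atTop_finset_of_monotone (fun _ _ => Finset.powerset_mono.2)
      fun s => ⟨s, Finset.mem_powerset_self s⟩
  have hsum := (hT.summable_principalMinor hs e).hasSum
  have hlim := hsum.comp hpowerset
  simp only [Function.comp_def, sum_powerset_principalMinor] at hlim
  rwa [tendsto_nhds_unique hlim (hT.tendsto_det_compression hs e)] at hsum

end FredholmDet

/-! ### Square summable families in `L²` -/

theorem summable_mul_of_summable_sq {ι : Type*} {r s : ι → ℝ} (hr : Summable fun n => r n ^ 2)
    (hs : Summable fun n => s n ^ 2) : Summable fun n => r n * s n := by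
  refine Summable.of_norm_bounded (hr.add hs) fun n => ?_
  rw [Real.norm_eq_abs, abs_le]
  constructor <;> nlinarith [sq_nonneg (r n + s n), sq_nonneg (r n - s n)]

theorem exists_norm_sq_eq_and_inner_smul_eq {𝕜 E : Type*} [RCLike 𝕜] [NormedAddCommGroup E]
    [InnerProductSpace 𝕜 E] (x y : E) :
    ∃ x' y' : E, ‖x'‖ ^ 2 = ‖x‖ * ‖y‖ ∧ ‖y'‖ ^ 2 = ‖x‖ * ‖y‖ ∧
      ∀ z, inner 𝕜 x' z • y' = inner 𝕜 x z • y := by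
  obtain rfl | hx := eq_or_ne x 0
  · exact ⟨0, 0, by simp⟩
  obtain rfl | hy := eq_or_ne y 0
  · exact ⟨0, 0, by simp⟩
  have hyx : 0 < ‖y‖ / ‖x‖ := div_pos (norm_pos_iff.2 hy) (norm_pos_iff.2 hx)
  obtain ⟨t, ht, ht'⟩ : ∃ t : ℝ, 0 < t ∧ t ^ 2 = ‖y‖ / ‖x‖ :=
    ⟨√(‖y‖ / ‖x‖), Real.sqrt_pos.2 hyx, Real.sq_sqrt hyx.le⟩
  have htc : (t : 𝕜) ≠ 0 := by exact_mod_cast ht.ne'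
  refine ⟨(t : 𝕜) • x, (t : 𝕜)⁻¹ • y, ?_, ?_, fun z => ?_⟩
  · rw [norm_smul, RCLike.norm_ofReal, mul_pow, sq_abs, ht']
    field_simp
  · rw [norm_smul, norm_inv, RCLike.norm_ofReal, mul_pow, inv_pow, sq_abs, ht']
    field_simp
  · rw [inner_smul_left, RCLike.conj_ofReal, smul_smul, mul_right_comm, mul_inv_cancel₀ htc,
      one_mul]

theorem IsTraceClass.exists_hasRankOneExpansion {E : Type uE} [NormedAddCommGroup E]
    [InnerProductSpace ℂ E] {T : E →L[ℂ] E} (hT : IsTraceClass T) :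
    ∃ a b : ℕ → E, (Summable fun n => ‖a n‖ ^ 2) ∧ (Summable fun n => ‖b n‖ ^ 2) ∧
      HasRankOneExpansion a b T := by
  obtain ⟨a, b, hs, h⟩ := hT
  choose a' b' ha' hb' hab using
    fun n => exists_norm_sq_eq_and_inner_smul_eq (𝕜 := ℂ) (a n) (b n)
  exact ⟨a', b', by simpa only [ha'] using hs, by simpa only [hb'] using hs,
    fun x => by simpa only [hab] using h x⟩

section L2

variable {𝕜 X ι : Type*} [RCLike 𝕜] [MeasurableSpace X] {ρ : Measure X}

theorem norm_sq_eq_integral_norm_sq (φ : Lp 𝕜 2 ρ) : ‖φ‖ ^ 2 = ∫ x, ‖φ x‖ ^ 2 ∂ρ := by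
  have h := L2.inner_def (𝕜 := 𝕜) φ φ
  simp only [inner_self_eq_norm_sq_to_K, ← RCLike.ofReal_pow, integral_ofReal] at h
  exact RCLike.ofReal_injective h

theorem integral_norm_mul_norm_le (φ ψ : Lp 𝕜 2 ρ) : ∫ x, ‖φ x‖ * ‖ψ x‖ ∂ρ ≤ ‖φ‖ * ‖ψ‖ := by
  have hφ : MemLp φ (ENNReal.ofReal 2) ρ := by simpa using Lp.memLp φ
  have hψ : MemLp ψ (ENNReal.ofReal 2) ρ := by simpa using Lp.memLp ψ
  simpa only [Real.rpow_two, ← norm_sq_eq_integral_norm_sq, ← Real.sqrt_eq_rpow,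
    Real.sqrt_sq (norm_nonneg _)]
    using integral_mul_norm_le_Lp_mul_Lq Real.HolderConjugate.two_two hφ hψ

theorem ae_summable_norm_sq [Countable ι] {x : ι → Lp 𝕜 2 ρ} (hx : Summable fun n => ‖x n‖ ^ 2) :
    ∀ᵐ u ∂ρ, Summable fun n => ‖x n u‖ ^ 2 := by
  have hm : ∀ n, AEMeasurable (fun u => ENNReal.ofReal (‖x n u‖ ^ 2)) ρ := fun n =>
    ((Lp.aestronglyMeasurable (x n)).norm.aemeasurable.pow_const 2).ennreal_ofReal
  have hint : ∀ n, ∫⁻ u, ENNReal.ofReal (‖x n u‖ ^ 2) ∂ρ = ENNReal.ofReal (‖x n‖ ^ 2) := fun n => by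
    rw [norm_sq_eq_integral_norm_sq, ofReal_integral_eq_lintegral_ofReal
      ((Lp.memLp (x n)).integrable_norm_pow (by norm_num)) (.of_forall fun _ => by positivity)]
  have hfin : ∫⁻ u, ∑' n, ENNReal.ofReal (‖x n u‖ ^ 2) ∂ρ ≠ ∞ := by
    simpa only [lintegral_tsum hm, hint] using hx.tsum_ofReal_ne_top
  filter_upwards [ae_lt_top' (AEMeasurable.tsum hm) hfin] with u hu
  refine (ENNReal.summable_toReal hu.ne).congr fun n => ?_
  rw [ENNReal.toReal_ofReal (by positivity)]

theorem summable_smul_of_summable_sq {E : Type*} [NormedAddCommGroup E] [NormedSpace 𝕜 E]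
    [CompleteSpace E] {r : ι → 𝕜} {x : ι → E} (hr : Summable fun n => ‖r n‖ ^ 2)
    (hx : Summable fun n => ‖x n‖ ^ 2) : Summable fun n => r n • x n :=
  .of_norm <| by simpa only [norm_smul] using summable_mul_of_summable_sq hr hx

theorem ae_hasSum_mul_apply [Countable ι] {r : ι → 𝕜} {x : ι → Lp 𝕜 2 ρ} {y : Lp 𝕜 2 ρ}
    (hr : Summable fun n => ‖r n‖ ^ 2) (hx : Summable fun n => ‖x n‖ ^ 2)
    (hy : HasSum (fun n => r n • x n) y) : ∀ᵐ u ∂ρ, HasSum (fun n => r n * x n u) (y u) := by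
  have hfin : ∑' n, ‖r n • x n‖ₑ ≠ ∞ := by
    have hs := summable_mul_of_summable_sq hr hx
    simp only [← norm_smul] at hs
    simpa only [ofReal_norm] using hs.tsum_ofReal_ne_top
  have hsmul : ∀ᵐ u ∂ρ, ∀ n, (r n • x n : Lp 𝕜 2 ρ) u = r n * x n u :=
    ae_all_iff.2 fun n => Lp.coeFn_smul (r n) (x n)
  filter_upwards [Lp.hasSum_coeFn_tsum hfin, hsmul] with u hu hu'
  simpa only [hu', hy.tsum_eq] using hu

variable {D : Set X} (hD : MeasurableSet D)

theorem norm_toLp_indicator_le (φ : Lp 𝕜 2 ρ) : ‖((Lp.memLp φ).indicator hD).toLp‖ ≤ ‖φ‖ := by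
  rw [Lp.norm_toLp, Lp.norm_def]
  exact ENNReal.toReal_mono (Lp.eLpNorm_ne_top φ) (eLpNorm_indicator_le _)

/-- The orthogonal projection of `L²` onto the functions that vanish outside of `D`, which is the
multiplication by the indicator function of `D`. -/
noncomputable def indicatorProj : Lp 𝕜 2 ρ →L[𝕜] Lp 𝕜 2 ρ :=
  LinearMap.mkContinuous
    { toFun := fun φ => ((Lp.memLp φ).indicator hD).toLp
      map_add' := fun φ ψ => by
        rw [← MemLp.toLp_add, MemLp.toLp_eq_toLp_iff, ← indicator_add']
        exact (Lp.coeFn_add φ ψ).mono fun x hx => by simp only [indicator, hx]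
      map_smul' := fun c φ => by
        rw [RingHom.id_apply, ← MemLp.toLp_const_smul, MemLp.toLp_eq_toLp_iff]
        exact (Lp.coeFn_smul c φ).mono fun x hx => by
          simp only [indicator, hx, Pi.smul_apply, smul_ite, smul_zero] } 1
    fun φ => (norm_toLp_indicator_le hD φ).trans_eq (one_mul _).symm

theorem indicatorProj_apply (φ : Lp 𝕜 2 ρ) :
    indicatorProj hD φ = ((Lp.memLp φ).indicator hD).toLp := rfl

theorem indicatorProj_coeFn (φ : Lp 𝕜 2 ρ) : indicatorProj hD φ =ᵐ[ρ] D.indicator φ := by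
  rw [indicatorProj_apply]
  exact MemLp.coeFn_toLp _

theorem inner_indicatorProj (φ ψ : Lp 𝕜 2 ρ) :
    inner 𝕜 φ (indicatorProj hD ψ) = ∫ x in D, inner 𝕜 (φ x) (ψ x) ∂ρ := by
  rw [L2.inner_def, ← integral_indicator hD]
  refine integral_congr_ae ((indicatorProj_coeFn hD ψ).mono fun x hx => ?_)
  by_cases h : x ∈ D <;> simp [hx, h]

theorem isStarProjection_indicatorProj :
    IsStarProjection (indicatorProj hD : Lp 𝕜 2 ρ →L[𝕜] Lp 𝕜 2 ρ) where
  isIdempotentElem := ContinuousLinearMap.ext fun φ => Lp.ext <| by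
    filter_upwards [indicatorProj_coeFn hD φ, indicatorProj_coeFn hD (indicatorProj hD φ)]
      with x h h'
    by_cases hx : x ∈ D <;> simp [mul_apply_eq_comp, h', hx, h]
  isSelfAdjoint := ContinuousLinearMap.isSelfAdjoint_iff_isSymmetric.2 fun φ ψ => by
    simp only [ContinuousLinearMap.coe_coe]
    rw [inner_indicatorProj, ← inner_conj_symm, inner_indicatorProj, ← integral_conj]
    simp only [inner_conj_symm]

theorem one_sub_indicatorProj :
    1 - indicatorProj hD = (indicatorProj hD.compl : Lp 𝕜 2 ρ →L[𝕜] Lp 𝕜 2 ρ) := by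
  refine ContinuousLinearMap.ext fun φ => Lp.ext ?_
  filter_upwards [indicatorProj_coeFn hD φ, indicatorProj_coeFn hD.compl φ,
    Lp.coeFn_sub φ (indicatorProj hD φ)] with x h h' hs
  rw [h', indicator_compl, Pi.sub_apply, ← h]
  exact hs

theorem ae_eq_zero_of_forall_setIntegral_eq_zero_of_isPiSystem {C : Set (Set X)}
    (hgen : ‹MeasurableSpace X› = MeasurableSpace.generateFrom C) (hC : IsPiSystem C)
    (huniv : univ ∈ C) {g : X → 𝕜} (hg : Integrable g ρ) (h : ∀ A ∈ C, ∫ x in A, g x ∂ρ = 0) :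
    g =ᵐ[ρ] 0 := by
  have hmeas : ∀ A ∈ C, MeasurableSet A := fun A hA =>
    hgen ▸ MeasurableSpace.measurableSet_generateFrom hA
  have hval : ∀ A ∈ C, ρ.withDensityᵥ g A = ρ.withDensityᵥ (0 : X → 𝕜) A := fun A hA => by
    rw [withDensityᵥ_apply hg (hmeas A hA), h A hA, withDensityᵥ_zero, FunLike.coe_zero,
      Pi.zero_apply]
  exact hg.ae_eq_of_withDensityᵥ_eq (integrable_zero _ _ _)
    (VectorMeasure.ext_of_generateFrom C hval hgen hC (hval _ huniv))

theorem exists_countable_generating_isPiSystem [MeasurableSpace.CountablyGenerated X] :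
    ∃ C : Set (Set X), C.Countable ∧ ‹MeasurableSpace X› = MeasurableSpace.generateFrom C ∧
      IsPiSystem C ∧ univ ∈ C := by
  have hC := isSetAlgebra_generateSetAlgebra (𝒜 := MeasurableSpace.countableGeneratingSet X)
  refine ⟨_, countable_generateSetAlgebra MeasurableSpace.countable_countableGeneratingSet, ?_,
    fun s hs t ht _ => hC.inter_mem hs ht, hC.univ_mem⟩
  rw [generateFrom_generateSetAlgebra_eq, MeasurableSpace.generateFrom_countableGeneratingSet]

theorem mul_indicatorConstLp_ae_eq (g : X → 𝕜) (hD : MeasurableSet D) (hD' : ρ D ≠ ∞) :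
    (fun x => g x * indicatorConstLp 2 hD hD' (1 : 𝕜) x) =ᵐ[ρ] D.indicator g := by
  filter_upwards [indicatorConstLp_coeFn (p := 2) (hs := hD) (hμs := hD') (c := (1 : 𝕜))] with x hx
  by_cases h : x ∈ D <;> simp [hx, h]

variable (𝕜) in
theorem exists_countable_testing [MeasurableSpace.CountablyGenerated X] (ρ : Measure X)
    [SigmaFinite ρ] : ∃ 𝒯 : Set (Lp 𝕜 2 ρ), 𝒯.Countable ∧ ∀ g : X → 𝕜,
      (∀ φ ∈ 𝒯, Integrable (fun x => g x * φ x) ρ ∧ ∫ x, g x * φ x ∂ρ = 0) → g =ᵐ[ρ] 0 := by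
  obtain ⟨C, hcount, hgen, hC, huniv⟩ := exists_countable_generating_isPiSystem (X := X)
  have : Countable C := hcount.to_subtype
  have hmeas (m : ℕ) (A : C) : MeasurableSet (A ∩ spanningSets ρ m) :=
    .inter (by rw [hgen]; exact MeasurableSpace.measurableSet_generateFrom A.2)
      (measurableSet_spanningSets ρ m)
  have hfin (m : ℕ) (A : C) : ρ (A ∩ spanningSets ρ m) ≠ ∞ :=
    ((measure_mono inter_subset_right).trans_lt (measure_spanningSets_lt_top ρ m)).ne
  refine ⟨range fun p : ℕ × C => indicatorConstLp 2 (hmeas p.1 p.2) (hfin p.1 p.2) 1,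
    countable_range _, fun g hg => ?_⟩
  have hint (m : ℕ) (A : C) : IntegrableOn g (A ∩ spanningSets ρ m) ρ :=
    (integrable_indicator_iff (hmeas m A)).1 <|
      (hg _ ⟨(m, A), rfl⟩).1.congr (mul_indicatorConstLp_ae_eq g _ _)
  have hzero (m : ℕ) (A : C) : ∫ x in A ∩ spanningSets ρ m, g x ∂ρ = 0 := by
    rw [← integral_indicator (hmeas m A),
      ← integral_congr_ae (mul_indicatorConstLp_ae_eq g (hmeas m A) (hfin m A))]
    exact (hg _ ⟨(m, A), rfl⟩).2
  have hspan (m : ℕ) : ∀ᵐ x ∂(ρ.restrict (spanningSets ρ m)), g x = 0 := by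
    refine ae_eq_zero_of_forall_setIntegral_eq_zero_of_isPiSystem hgen hC huniv
      (by simpa only [univ_inter, IntegrableOn] using hint m ⟨univ, huniv⟩) fun A hA => ?_
    rw [Measure.restrict_restrict' (measurableSet_spanningSets ρ m)]
    exact hzero m ⟨A, hA⟩
  have h := (ae_restrict_iUnion_iff (spanningSets ρ) fun x => g x = 0).2 hspan
  rwa [iUnion_spanningSets, Measure.restrict_univ] at h

end L2

/-! ### Kernels of nuclear integral operators -/

section NuclearKernel

open scoped ComplexConjugate

/-- `T` is the integral operator on `L²(ρ)` with kernel `K`: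
`(T φ)(u) = ∫ K(u, v) φ(v) dρ(v)` for almost every `u`. -/
def HasIntegralKernel {𝕜 X : Type*} [RCLike 𝕜] [MeasurableSpace X] {ρ : Measure X}
    (K : X → X → 𝕜) (T : Lp 𝕜 2 ρ →L[𝕜] Lp 𝕜 2 ρ) : Prop :=
  ∀ φ : Lp 𝕜 2 ρ, ∀ᵐ u ∂ρ,
    Integrable (fun v => K u v * φ v) ρ ∧ T φ u = ∫ v, K u v * φ v ∂ρ

theorem hasSum_inner_of_hasSum_conj_smul {𝕜 E ι : Type*} [RCLike 𝕜] [NormedAddCommGroup E]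
    [InnerProductSpace 𝕜 E] {r : ι → 𝕜} {a : ι → E} {κ : E}
    (hκ : HasSum (fun n => conj (r n) • a n) κ) (ψ : E) :
    HasSum (fun n => inner 𝕜 (a n) ψ * r n) (inner 𝕜 κ ψ) := by
  have h := (hκ.mapL (innerSL 𝕜 ψ)).map (starRingEnd 𝕜) RCLike.continuous_conj
  simp only [innerSL_apply_apply, inner_conj_symm] at h
  refine h.congr_fun fun n => ?_
  rw [Function.comp_apply, inner_conj_symm, inner_smul_left, RCLike.conj_conj, mul_comm]

theorem ae_eq_prod_of_ae_ae_eq {X Y Z : Type*} [MeasurableSpace X] [MeasurableSpace Y]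
    [MeasurableSpace Z] [MeasurableEq Z] {μ : Measure X} {ν : Measure Y} [SFinite ν]
    {f g : X × Y → Z} (hf : AEMeasurable f (μ.prod ν)) (hg : AEMeasurable g (μ.prod ν))
    (h : ∀ᵐ x ∂μ, ∀ᵐ y ∂ν, f (x, y) = g (x, y)) : f =ᵐ[μ.prod ν] g := by
  have hmk : hf.mk f =ᵐ[μ.prod ν] hg.mk g := by
    refine (Measure.ae_prod_iff_ae_ae
      (measurableSet_eq_fun hf.measurable_mk hg.measurable_mk)).2 ?_
    filter_upwards [h, Measure.ae_ae_of_ae_prod hf.ae_eq_mk, Measure.ae_ae_of_ae_prod hg.ae_eq_mk]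
      with x h hf hg
    filter_upwards [h, hf, hg] with y h hf hg
    rw [← hf, ← hg, h]
  exact hf.ae_eq_mk.trans (hmk.trans hg.ae_eq_mk.symm)

variable {𝕜 X ι : Type*} [RCLike 𝕜] [MeasurableSpace X] {ρ : Measure X} [Countable ι]
  {a b : ι → Lp 𝕜 2 ρ} (ha : Summable fun n => ‖a n‖ ^ 2) (hb : Summable fun n => ‖b n‖ ^ 2)
include ha hb

variable {T : Lp 𝕜 2 ρ →L[𝕜] Lp 𝕜 2 ρ} (hT : HasRankOneExpansion a b T)
include hT

theorem HasRankOneExpansion.ae_hasSum_apply (φ : Lp 𝕜 2 ρ) :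
    ∀ᵐ u ∂ρ, HasSum (fun n => inner 𝕜 (a n) φ * b n u) (T φ u) := by
  refine ae_hasSum_mul_apply ?_ hb (hT φ)
  refine (ha.mul_right (‖φ‖ ^ 2)).of_nonneg_of_le (fun n => by positivity) fun n => ?_
  rw [← mul_pow]
  exact pow_le_pow_left₀ (norm_nonneg _) (norm_inner_le_norm _ _) 2

variable [MeasurableSpace.CountablyGenerated X] [SigmaFinite ρ] {K : X → X → 𝕜}
  (hK : HasIntegralKernel K T)
include hK

theorem HasRankOneExpansion.ae_exists_kernel_row : ∀ᵐ u ∂ρ, ∃ κ : Lp 𝕜 2 ρ,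
    HasSum (fun n => conj (b n u) • a n) κ ∧ ∀ᵐ v ∂ρ, K u v = conj (κ v) := by
  obtain ⟨𝒯, hcount, htest⟩ := exists_countable_testing 𝕜 ρ
  filter_upwards [(ae_ball_iff hcount).2 fun φ _ => hK φ,
    (ae_ball_iff hcount).2 fun φ _ => hT.ae_hasSum_apply ha hb φ, ae_summable_norm_sq hb]
    with u hKu hTu hbu
  have hκ := (summable_smul_of_summable_sq (by simpa only [RCLike.norm_conj] using hbu) ha :
    Summable fun n => conj (b n u) • a n).hasSum
  refine ⟨_, hκ, ?_⟩
  set κ := ∑' n, conj (b n u) • a n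
  have heq (φ : Lp 𝕜 2 ρ) (v : X) :
      (K u v - conj (κ v)) * φ v = K u v * φ v - inner 𝕜 (κ v) (φ v) := by
    rw [RCLike.inner_apply]
    ring
  have hzero := htest (fun v => K u v - conj (κ v)) fun φ hφ => by
    simp only [heq]
    refine ⟨(hKu φ hφ).1.sub (L2.integrable_inner κ φ), ?_⟩
    rw [integral_sub (hKu φ hφ).1 (L2.integrable_inner κ φ), ← (hKu φ hφ).2, ← L2.inner_def,
      (hTu φ hφ).unique (hasSum_inner_of_hasSum_conj_smul hκ φ), sub_self]
  exact hzero.mono fun v hv => sub_eq_zero.1 hv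

theorem HasRankOneExpansion.ae_ae_hasSum_kernel :
    ∀ᵐ u ∂ρ, ∀ᵐ v ∂ρ, HasSum (fun n => b n u * conj (a n v)) (K u v) := by
  filter_upwards [hT.ae_exists_kernel_row ha hb hK, ae_summable_norm_sq hb]
    with u ⟨κ, hκ, hKκ⟩ hbu
  filter_upwards [hKκ, ae_hasSum_mul_apply (by simpa only [RCLike.norm_conj] using hbu) ha hκ]
    with v hv hsum
  rw [hv]
  refine (hsum.map (starRingEnd 𝕜) RCLike.continuous_conj).congr_fun fun n => ?_
  rw [Function.comp_apply, map_mul, RCLike.conj_conj]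

variable (hKm : AEMeasurable (Function.uncurry K) (ρ.prod ρ))
include hKm

theorem HasRankOneExpansion.ae_exists_kernel_column : ∀ᵐ w ∂ρ, ∃ l : Lp 𝕜 2 ρ,
    HasSum (fun n => conj (a n w) • b n) l ∧ ∀ᵐ u ∂ρ, K u w = l u := by
  have hmeas : Measurable fun p : X × X => ∑' n, b n p.1 * conj (a n p.2) := by
    refine .tsum fun n => ?_
    exact ((Lp.stronglyMeasurable (b n)).measurable.comp measurable_fst).mul
      (RCLike.continuous_conj.measurable.comp
        ((Lp.stronglyMeasurable (a n)).measurable.comp measurable_snd))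
  have hprod := ae_eq_prod_of_ae_ae_eq hKm hmeas.aemeasurable
    ((hT.ae_ae_hasSum_kernel ha hb hK).mono fun u hu => hu.mono fun v hv => hv.tsum_eq.symm)
  filter_upwards [Measure.ae_ae_of_ae_prod (Measure.measurePreserving_swap.quasiMeasurePreserving.ae
    hprod), ae_summable_norm_sq ha] with w hw haw
  have haw' : Summable fun n => ‖conj (a n w)‖ ^ 2 := by simpa only [RCLike.norm_conj] using haw
  have hl := (summable_smul_of_summable_sq haw' hb).hasSum
  refine ⟨_, hl, ?_⟩
  filter_upwards [hw, ae_hasSum_mul_apply haw' hb hl] with u hu hsum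
  refine hu.trans (Eq.trans ?_ hsum.tsum_eq)
  exact tsum_congr fun n => mul_comm _ _

/-- On the diagonal this is not a consequence of the expansion of `K`, which only holds almost
everywhere. -/
theorem HasRankOneExpansion.exists_hasSum_setIntegral_kernel {D : Set X} (hD : MeasurableSet D) :
    ∃ S : Set X, (∀ᵐ u ∂ρ, u ∈ S) ∧ ∀ u ∈ S, ∀ w ∈ S,
      HasSum (fun n => T (indicatorProj hD (b n)) u * conj (a n w))
        (∫ v in D, K u v * K v w ∂ρ) := by
  refine ⟨_, (hT.ae_exists_kernel_row ha hb hK).and ((hT.ae_exists_kernel_column ha hb hK hKm).and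
    (ae_all_iff.2 fun n => hT.ae_hasSum_apply ha hb (indicatorProj hD (b n)))), ?_⟩
  rintro u ⟨⟨κ, hκ, hKκ⟩, -, hTu⟩ w ⟨-, ⟨l, hl, hKl⟩, -⟩
  have hinner : ∫ v in D, K u v * K v w ∂ρ = inner 𝕜 κ (indicatorProj hD l) := by
    rw [inner_indicatorProj]
    refine integral_congr_ae (ae_restrict_of_ae ?_)
    filter_upwards [hKκ, hKl] with v hv hv'
    rw [hv, hv', RCLike.inner_apply, mul_comm]
  have hsum := (hl.mapL (indicatorProj hD)).mapL (innerSL 𝕜 κ)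
  simp only [innerSL_apply_apply, map_smul, smul_eq_mul, ← hinner] at hsum
  refine hsum.congr_fun fun n => ?_
  rw [(hTu n).unique (hasSum_inner_of_hasSum_conj_smul hκ _), mul_comm]

end NuclearKernel

/-! ### Fredholm series of off-diagonal integral operators -/

section KernelDeterminant

open scoped ComplexConjugate

variable {𝕜 X ι : Type*} [RCLike 𝕜] [MeasurableSpace X] {ρ : Measure X}

theorem integrable_mul_conj (β a : Lp 𝕜 2 ρ) : Integrable (fun x => β x * conj (a x)) ρ := by
  simpa only [RCLike.inner_apply] using L2.integrable_inner (𝕜 := 𝕜) a β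

theorem setIntegral_norm_mul_conj_le (β a : Lp 𝕜 2 ρ) (D : Set X) :
    ∫ x in D, ‖β x * conj (a x)‖ ∂ρ ≤ ‖β‖ * ‖a‖ := by
  refine (setIntegral_le_integral (integrable_mul_conj β a).norm
    (.of_forall fun _ => norm_nonneg _)).trans ?_
  simpa only [norm_mul, RCLike.norm_conj] using integral_norm_mul_norm_le β a

variable [Countable ι] [SigmaFinite ρ] {a β : ι → Lp 𝕜 2 ρ} {κ : X → X → 𝕜} {S : Set X}
  (hs : Summable fun n => ‖a n‖ * ‖β n‖) (hS : ∀ᵐ x ∂ρ, x ∈ S)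
  (h : ∀ x ∈ S, ∀ y ∈ S, HasSum (fun n => β n x * conj (a n y)) (κ x y)) (k : ℕ)
include hs hS h

theorem integrable_det_kernel_restrict (D : Set X) :
    Integrable (fun x : Fin k → X => (Matrix.of fun i j => κ (x i) (x j)).det)
      (Measure.pi fun _ => ρ.restrict D) :=
  integrable_det_kernel (hs.congr fun _ => mul_comm _ _)
    (fun n m => (integrable_mul_conj (β n) (a m)).restrict)
    (fun n m => setIntegral_norm_mul_conj_le (β n) (a m) D) (ae_restrict_of_ae hS) h k

theorem integral_det_kernel_restrict {D : Set X} (hD : MeasurableSet D) :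
    ∫ x, (Matrix.of fun i j => κ (x i) (x j)).det ∂(Measure.pi fun _ : Fin k => ρ.restrict D) =
      ∑' ν : Fin k → ι, (crossGram 𝕜 (a ∘ ν) fun i => indicatorProj hD (β (ν i))).det := by
  rw [integral_det_kernel (hs.congr fun _ => mul_comm _ _)
    (fun n m => (integrable_mul_conj (β n) (a m)).restrict)
    (fun n m => setIntegral_norm_mul_conj_le (β n) (a m) D) (ae_restrict_of_ae hS) h k]
  refine tsum_congr fun ν => ?_
  rw [← Matrix.det_transpose]
  congr 1
  ext i j
  simp only [Matrix.transpose_apply, Matrix.of_apply, crossGram, inner_indicatorProj,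
    RCLike.inner_apply, Function.comp_apply]

end KernelDeterminant

theorem HasIntegralKernel.indicatorProj_comp_comp_eq_zero {𝕜 X : Type*} [RCLike 𝕜]
    [MeasurableSpace X] {ρ : Measure X} {K : X → X → 𝕜} {T : Lp 𝕜 2 ρ →L[𝕜] Lp 𝕜 2 ρ}
    (hK : HasIntegralKernel K T) {D D' : Set X} (hD : MeasurableSet D) (hD' : MeasurableSet D')
    (h : ∀ u ∈ D', ∀ v ∈ D, K u v = 0) : indicatorProj hD' ∘L T ∘L indicatorProj hD = 0 := by
  refine ContinuousLinearMap.ext fun φ => Lp.ext ?_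
  filter_upwards [indicatorProj_coeFn hD' (T (indicatorProj hD φ)), hK (indicatorProj hD φ),
    Lp.coeFn_zero 𝕜 2 ρ] with u hu hKu hzero
  rw [ContinuousLinearMap.comp_apply, ContinuousLinearMap.comp_apply, hu, zero_apply, hzero,
    Pi.zero_apply]
  refine indicator_apply_eq_zero.2 fun huD' => ?_
  rw [hKu.2]
  refine integral_eq_zero_of_ae ((indicatorProj_coeFn hD φ).mono fun v hv => ?_)
  by_cases hvD : v ∈ D <;> simp [hv, hvD, h u huD' v]

section Fredholm

variable {ρ : Measure ℂ} {τ : ℂ → ℂ} {K : ℂ → ℂ → ℂ} {T : Lp ℂ 2 ρ →L[ℂ] Lp ℂ 2 ρ}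

theorem IsIntegralOperator.hasIntegralKernel (hT : IsIntegralOperator ρ τ K T) :
    HasIntegralKernel (fun u v => K u v * τ v) T := by
  simpa only [HasIntegralKernel, IsIntegralOperator, mul_right_comm _ (τ _)] using hT

theorem fredholmIntegrand_compKernel (ρ : Measure ℂ) (τ : ℂ → ℂ) (K L : ℂ → ℂ → ℂ) (n : ℕ) :
    fredholmIntegrand τ (compKernel ρ τ K L) n = fun x =>
      (Matrix.of fun i j => ∫ v, K (x i) v * τ v * (L v (x j) * τ (x j)) ∂ρ).det := by
  ext x
  rw [fredholmIntegrand, mul_comm, ← Matrix.det_mul_row]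
  congr 1
  ext i j
  rw [Matrix.of_apply, Matrix.of_apply, Matrix.of_apply, compKernel, mul_comm, ← integral_mul_const]
  exact integral_congr_ae (.of_forall fun v => by ring)

theorem summable_norm_comp_mul_norm {𝕜 E ι : Type*} [RCLike 𝕜] [NormedAddCommGroup E]
    [NormedSpace 𝕜 E] {a b : ι → E} (hs : Summable fun n => ‖a n‖ * ‖b n‖) (T : E →L[𝕜] E) :
    Summable fun n => ‖a n‖ * ‖T (b n)‖ := by
  refine (hs.mul_left ‖T‖).of_nonneg_of_le (fun n => by positivity) fun n => ?_
  rw [mul_left_comm]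
  exact mul_le_mul_of_nonneg_left (T.le_opNorm _) (norm_nonneg _)

section Expansion

variable [SigmaFinite ρ] {a b : ℕ → Lp ℂ 2 ρ} (ha : Summable fun n => ‖a n‖ ^ 2)
  (hb : Summable fun n => ‖b n‖ ^ 2) (hab : HasRankOneExpansion a b T)
  (hTK : IsIntegralOperator ρ τ K T) (hKm : AEMeasurable (Function.uncurry K) (ρ.prod ρ))
  (hτ : AEMeasurable τ ρ) {D D' : Set ℂ} (hD' : MeasurableSet D')
include ha hb hab hTK hKm hτ hD'

theorem HasRankOneExpansion.exists_hasSum_compKernel : ∃ S : Set ℂ, (∀ᵐ u ∂ρ, u ∈ S) ∧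
    ∀ u ∈ S, ∀ w ∈ S,
      HasSum (fun n => (T ∘L indicatorProj hD') (b n) u * starRingEnd ℂ (a n w))
        (∫ v in D', K u v * τ v * (K v w * τ w) ∂ρ) :=
  hab.exists_hasSum_setIntegral_kernel ha hb hTK.hasIntegralKernel
    (hKm.mul (hτ.comp_quasiMeasurePreserving Measure.quasiMeasurePreserving_snd)) hD'

theorem HasRankOneExpansion.integrable_fredholmIntegrand_compKernel (n : ℕ) :
    Integrable (fredholmIntegrand τ (compKernel (ρ.restrict D') τ K K) n)
      (Measure.pi fun _ => ρ.restrict D) := by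
  obtain ⟨S, hS, hsum⟩ := hab.exists_hasSum_compKernel ha hb hTK hKm hτ hD'
  rw [fredholmIntegrand_compKernel]
  exact integrable_det_kernel_restrict
    (summable_norm_comp_mul_norm (summable_mul_of_summable_sq ha hb) _) hS hsum n D

theorem HasRankOneExpansion.fredholmTerm_compKernel_eq (hD : MeasurableSet D) (n : ℕ) :
    fredholmTerm (ρ.restrict D) τ (compKernel (ρ.restrict D') τ K K) n =
      fredholmCoeff ℂ a
        (fun n => (indicatorProj hD ∘L T ∘L indicatorProj hD' : Lp ℂ 2 ρ →L[ℂ] _) (b n)) n := by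
  obtain ⟨S, hS, hsum⟩ := hab.exists_hasSum_compKernel ha hb hTK hKm hτ hD'
  rw [fredholmTerm, fredholmIntegrand_compKernel, fredholmCoeff, integral_det_kernel_restrict
    (summable_norm_comp_mul_norm (summable_mul_of_summable_sq ha hb) _) hS hsum n hD]
  rfl

end Expansion

/-- For `T = ∑ₙ ⟨aₙ, ·⟩ bₙ` the terms of the Fredholm series are those of the nuclear operator
`∑ₙ ⟨aₙ, ·⟩ P T (1 - P) bₙ`, where `P` is the projection to `L²(D)`; and `P T (1 - P) = P T`. -/
theorem IsIntegralOperator.fredholmSeries_offDiagonal [SigmaFinite ρ]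
    (hTK : IsIntegralOperator ρ τ K T) (hT : IsTraceClass T)
    (hKm : AEMeasurable (Function.uncurry K) (ρ.prod ρ)) (hτ : AEMeasurable τ ρ) {D : Set ℂ}
    (hD : MeasurableSet D) (h₁ : ∀ u ∈ D, ∀ v ∈ D, K u v = 0)
    (h₂ : ∀ u ∈ Dᶜ, ∀ v ∈ Dᶜ, K u v = 0) :
    FredholmSeriesWellDefined (ρ.restrict D) τ (compKernel (ρ.restrict Dᶜ) τ K K) ∧
      HasFredholmDet T (fredholmSeries (ρ.restrict D) τ (compKernel (ρ.restrict Dᶜ) τ K K)) := by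
  obtain ⟨a, b, ha, hb, hab⟩ := hT.exists_hasRankOneExpansion
  have hs : Summable fun n => ‖a n‖ * ‖b n‖ := summable_mul_of_summable_sq ha hb
  have hk := hTK.hasIntegralKernel
  set P : Lp ℂ 2 ρ →L[ℂ] Lp ℂ 2 ρ := indicatorProj hD with hP
  have hP₁ : P ∘L T ∘L P = 0 :=
    hk.indicatorProj_comp_comp_eq_zero hD hD fun u hu v hv => by rw [h₁ u hu v hv, zero_mul]
  have hP₂ : (1 - P) ∘L T ∘L (1 - P) = 0 := by
    rw [one_sub_indicatorProj]
    exact hk.indicatorProj_comp_comp_eq_zero _ _ fun u hu v hv => by rw [h₂ u hu v hv, zero_mul]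
  have hPT : P ∘L T ∘L indicatorProj hD.compl = P ∘L T := by
    rw [← one_sub_indicatorProj hD, ← hP, ContinuousLinearMap.comp_sub,
      ContinuousLinearMap.comp_sub, hP₁, sub_zero]
    rfl
  have hterm := hab.fredholmTerm_compKernel_eq ha hb hTK hKm hτ hD.compl hD
  simp only [← hP, hPT] at hterm
  refine ⟨⟨hab.integrable_fredholmIntegrand_compKernel ha hb hTK hKm hτ hD.compl, ?_⟩, ?_⟩
  · rw [funext hterm]
    exact summable_fredholmCoeff (summable_norm_comp_mul_norm hs _)
  · rw [fredholmSeries, tsum_congr hterm, ← fredholmSum]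
    exact hab.fredholmSum_eq_of_offDiagonal (isStarProjection_indicatorProj hD) hs hP₁ hP₂ ▸
      hab.hasFredholmDet hs

end Fredholm

/-! ### The operators of block data -/

open scoped Function in
theorem sum_eq_of_mem_of_disjoint {ι X M : Type*} [Fintype ι] [AddCommMonoid M]
    {S : ι → Set X} (hS : Pairwise (Disjoint on S)) {i : ι} {x : X} (hx : x ∈ S i) {a : ι → M}
    (ha : ∀ j, x ∉ S j → a j = 0) : ∑ j, a j = a i :=
  Fintype.sum_eq_single i fun j hj => ha j (disjoint_right.1 (hS hj) hx)

namespace BlockData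

open scoped Function

variable {m : ℕ}

/-- The row of `F` which carries the function `A_i` on the set `Ω_{1,i}` (for `inl i`) or `Ω_{2,i}`
(for `inr i`); the row of `G` which carries `B_i` on that set belongs to the swapped index.
Rows are counted from `0`. -/
def row : Fin m ⊕ Fin m → Fin (m + 1)
  | .inl i => ⟨2 * ((i : ℕ) / 2), by omega⟩
  | .inr i => ⟨if (i : ℕ) = 0 then m else 2 * (((i : ℕ) - 1) / 2) + 1, by split_ifs <;> omega⟩

theorem row_inl_ne_row_inr (i j : Fin m) : row (.inl i) ≠ row (.inr j) := by
  simp only [row, ne_eq, Fin.mk.injEq]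
  split_ifs <;> omega

theorem row_ne_row_swap : ∀ s : Fin m ⊕ Fin m, row s ≠ row s.swap
  | .inl i => row_inl_ne_row_inr i i
  | .inr i => (row_inl_ne_row_inr i i).symm

theorem P_mul_L_apply_inl (k : Fin (m + 1)) (i : Fin m) :
    (P m * L m) k (.inl i) = if k = row (.inl i) then 1 else 0 := by
  have hsum : (P m * L m) k (.inl i) = ∑ j : Fin m, if (k : ℕ) = j then Lam₁ m j i else 0 := by
    rw [Matrix.mul_apply, Fintype.sum_sum_type, Finset.sum_eq_zero (f := fun j : Fin m =>
      P m k (.inr j) * L m (.inr j) (.inl i)) (by simp [L]), add_zero]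
    refine Finset.sum_congr rfl fun j _ => ?_
    by_cases h : (k : ℕ) = j <;> simp [P, L, h]
  rw [hsum]
  by_cases hk : (k : ℕ) < m
  · rw [Finset.sum_eq_single ⟨k, hk⟩ (fun j _ hj => if_neg fun h => hj (Fin.ext h.symm))
      (fun h => absurd (Finset.mem_univ _) h), if_pos rfl]
    simp only [Lam₁, Matrix.of_apply, Nat.odd_iff, Fin.ext_iff, row]
    refine if_congr ?_ rfl rfl
    omega
  · rw [Finset.sum_eq_zero fun j _ => if_neg (by omega), if_neg]
    simp only [row, Fin.ext_iff]
    omega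

theorem P_mul_L_apply_inr (k : Fin (m + 1)) (i : Fin m) :
    (P m * L m) k (.inr i) = if k = row (.inr i) then 1 else 0 := by
  have hsum : (P m * L m) k (.inr i) =
      (∑ j : Fin m, if (k : ℕ) = j then (Lam₂ m - E₁₁ m) j i else 0) +
        ∑ j : Fin m, if (k : ℕ) = m + j then E₁₁ m j i else 0 := by
    rw [Matrix.mul_apply, Fintype.sum_sum_type]
    congr 1 <;> refine Finset.sum_congr rfl fun j _ => ?_
    · by_cases h : (k : ℕ) = j <;> simp [P, L, h]
    · by_cases h : (k : ℕ) = m + j <;> simp [P, L, h]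
  rw [hsum]
  by_cases hk : (k : ℕ) < m
  · rw [Finset.sum_eq_single ⟨k, hk⟩ (fun j _ hj => if_neg fun h => hj (Fin.ext h.symm))
      (fun h => absurd (Finset.mem_univ _) h), if_pos rfl,
      Finset.sum_eq_zero (f := fun j : Fin m => if (k : ℕ) = m + j then E₁₁ m j i else 0)
        fun j _ => if_neg (by omega), add_zero]
    simp only [Lam₂, E₁₁, Matrix.sub_apply, Matrix.of_apply, Nat.even_iff, Fin.ext_iff, row]
    split_ifs <;> first | omega | simp
  · rw [Finset.sum_eq_zero fun j _ => if_neg (by omega), zero_add,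
      Finset.sum_eq_single ⟨0, i.pos⟩ (fun j _ hj => if_neg fun h => hj (Fin.ext (by grind)))
      (fun h => absurd (Finset.mem_univ _) h), if_pos (by grind)]
    simp only [E₁₁, Matrix.of_apply, Fin.ext_iff, row, true_and]
    split_ifs <;> first | omega | simp

theorem P_mul_L_mulVec (x : Fin m ⊕ Fin m → ℂ) :
    (P m * L m) *ᵥ x = ∑ s, Pi.single (row s) (x s) := by
  ext k
  simp [Matrix.mulVec, dotProduct, P_mul_L_apply_inl, P_mul_L_apply_inr, Pi.single_apply]

theorem kron_add_kron_add (i j : Fin m) :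
    kron ((i : ℤ) + 1) ((j : ℤ) + 1) + kron ((i : ℤ) + 1) ((j : ℤ) + 1 + (-1) ^ ((i : ℕ) + 1)) =
      if row (.inl i) = row (.inl j) then 1 else 0 := by
  simp only [kron, row, Fin.ext_iff]
  rcases Nat.even_or_odd ((i : ℕ) + 1) with h | h
  · rw [h.neg_one_pow]
    rw [Nat.even_iff] at h
    split_ifs <;> first | omega | simp
  · rw [h.neg_one_pow]
    rw [Nat.odd_iff] at h
    split_ifs <;> first | omega | simp

theorem kron_add_kron_sub (i j : Fin m) :
    kron ((i : ℤ) + 1) ((j : ℤ) + 1) + kron ((i : ℤ) + 1) ((j : ℤ) + 1 - (-1) ^ ((i : ℕ) + 1)) =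
      if row (.inr i) = row (.inr j) then 1 else 0 := by
  simp only [kron, row, Fin.ext_iff]
  rcases Nat.even_or_odd ((i : ℕ) + 1) with h | h
  · rw [h.neg_one_pow]
    rw [Nat.even_iff] at h
    split_ifs <;> first | omega | simp
  · rw [h.neg_one_pow]
    rw [Nat.odd_iff] at h
    split_ifs <;> first | omega | simp

variable (D : BlockData m)

/-- All the sets of the block data in one family: `Ω_{1,i}` for `inl i` and `Ω_{2,i}` for
`inr i`. -/
abbrev piece : Fin m ⊕ Fin m → Set ℂ := Sum.elim D.Ω₁ D.Ω₂

theorem Omega_eq_iUnion_piece : D.Omega = ⋃ s, D.piece s := by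
  rw [iUnion_sum]
  rfl

/-- The function `A_i` attached to the set with index `s`. -/
def pieceA (s : Fin m ⊕ Fin m) : ℂ → ℂ := D.A (s.elim id id)

/-- The function `B_i` attached to the set with index `s`. -/
def pieceB (s : Fin m ⊕ Fin m) : ℂ → ℂ := D.B (s.elim id id)

theorem F_eq_sum (z : ℂ) :
    D.F z = ∑ s, Pi.single (row s) ((D.piece s).indicator (D.pieceA s) z) := by
  simp only [F, P_mul_L_mulVec, Fintype.sum_sum_type, Sum.elim_inl, Sum.elim_inr, pieceA, id,
    ← indicator_mul_right, Pi.one_apply, mul_one]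

theorem G_eq_sum (z : ℂ) :
    D.G z = ∑ s, Pi.single (row s.swap) ((D.piece s).indicator (D.pieceB s) z) := by
  simp only [G, P_mul_L_mulVec, Fintype.sum_sum_type, Sum.elim_inl, Sum.elim_inr, pieceB, id,
    ← indicator_mul_right, Pi.one_apply, mul_one, Sum.swap_inl, Sum.swap_inr, add_comm]

/-- The diagonal entries of `Δ`. -/
def weight (k : Fin (m + 1)) (z : ℂ) : ℂ :=
  Fin.snoc (α := fun _ => ℂ) (fun j : Fin m => D.w j z) 1 k

theorem weight_of_lt {k : Fin (m + 1)} (h : (k : ℕ) < m) : D.weight k = D.w ⟨k, h⟩ := by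
  ext z
  simp only [weight, Fin.snoc, h, dif_pos]
  rfl

theorem weight_of_eq {k : Fin (m + 1)} (h : (k : ℕ) = m) : D.weight k = 1 := by
  ext z
  simp [weight, Fin.snoc, h]

theorem M_eq_weight_div_weight (i : Fin m) :
    D.M i = D.weight (row (.inl i)) / D.weight (row (.inr i)) := by
  have hinl : (row (.inl i) : ℕ) < m := by simp only [row]; omega
  ext z
  rw [M, D.weight_of_lt hinl, Pi.div_apply]
  by_cases h0 : (i : ℕ) = 0
  · rw [if_pos h0, D.weight_of_eq (by simp [row, h0]), Pi.one_apply, div_one]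
    congr 2
    exact Fin.ext (by simp [row, h0])
  · have hinr : (row (.inr i) : ℕ) < m := by simp only [row, h0, if_false]; omega
    rw [if_neg h0, D.weight_of_lt hinr]
    simp only [row, h0, if_false, Nat.even_iff]
    split_ifs <;> congr 3 <;> grind

theorem f_apply (z : ℂ) (k : Fin (m + 1)) : D.f z k = D.c z * (D.weight k z * D.F z k) := by
  simp [f, Delta, Matrix.mulVec_diagonal, weight]

theorem H_eq_div (u v : ℂ) : D.H u v = (D.f u ⬝ᵥ D.g v) / (u - v) := by
  rw [H]
  split_ifs with h
  · simp [h]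
  · rfl

section Values

variable {D}

theorem weight_ne_zero (hw0 : ∀ j, ∀ z ∈ D.Omega, D.w j z ≠ 0) (k : Fin (m + 1)) {z : ℂ}
    (hz : z ∈ D.Omega) : D.weight k z ≠ 0 := by
  by_cases h : (k : ℕ) < m
  · rw [D.weight_of_lt h]
    exact hw0 _ z hz
  · rw [D.weight_of_eq (by omega)]
    exact one_ne_zero

theorem g_apply (hw0 : ∀ j, ∀ z ∈ D.Omega, D.w j z ≠ 0) {z : ℂ} (hz : z ∈ D.Omega)
    (k : Fin (m + 1)) : D.g z k = (D.c z)⁻¹ * ((D.weight k z)⁻¹ * D.G z k) := by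
  have hinv : (D.Delta z)⁻¹ = Matrix.diagonal fun k => (D.weight k z)⁻¹ := by
    refine Matrix.inv_eq_right_inv ?_
    rw [Delta, Matrix.diagonal_mul_diagonal, ← Matrix.diagonal_one]
    congr 1
    ext k
    exact mul_inv_cancel₀ (weight_ne_zero hw0 k hz)
  simp [g, hinv, Matrix.mulVec_diagonal]

theorem f_eq_zero_of_notMem {z : ℂ} (hz : z ∉ D.Omega) : D.f z = 0 := by
  rw [Omega_eq_iUnion_piece, mem_iUnion, not_exists] at hz
  ext k
  simp [f_apply, F_eq_sum, indicator_of_notMem (hz _)]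

theorem g_eq_zero_of_notMem {z : ℂ} (hz : z ∉ D.Omega) : D.g z = 0 := by
  rw [Omega_eq_iUnion_piece, mem_iUnion, not_exists] at hz
  simp [g, G_eq_sum, indicator_of_notMem (hz _)]

variable {s t : Fin m ⊕ Fin m} {u v z : ℂ}

theorem mem_Omega_of_mem_piece (hz : z ∈ D.piece s) : z ∈ D.Omega := by
  rw [Omega_eq_iUnion_piece]
  exact mem_iUnion_of_mem s hz

theorem f_of_mem_piece (hdisj : Pairwise (Disjoint on D.piece)) (hz : z ∈ D.piece s) :
    D.f z = Pi.single (row s) (D.c z * (D.weight (row s) z * D.pieceA s z)) := by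
  have hF : D.F z = Pi.single (row s) (D.pieceA s z) := by
    rw [F_eq_sum, sum_eq_of_mem_of_disjoint hdisj hz fun t ht => by simp [ht],
      indicator_of_mem hz]
  ext k
  rw [f_apply, hF]
  obtain rfl | h := eq_or_ne k (row s) <;> simp [*]

theorem g_of_mem_piece (hdisj : Pairwise (Disjoint on D.piece))
    (hw0 : ∀ j, ∀ z ∈ D.Omega, D.w j z ≠ 0) (hz : z ∈ D.piece s) :
    D.g z = Pi.single (row s.swap)
      ((D.c z)⁻¹ * ((D.weight (row s.swap) z)⁻¹ * D.pieceB s z)) := by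
  have hG : D.G z = Pi.single (row s.swap) (D.pieceB s z) := by
    rw [G_eq_sum, sum_eq_of_mem_of_disjoint hdisj hz fun t ht => by simp [ht],
      indicator_of_mem hz]
  ext k
  rw [g_apply hw0 (mem_Omega_of_mem_piece hz), hG]
  obtain rfl | h := eq_or_ne k (row s.swap) <;> simp [*]

theorem f_mul_g_eq_zero (hdisj : Pairwise (Disjoint on D.piece))
    (hw0 : ∀ j, ∀ z ∈ D.Omega, D.w j z ≠ 0) (hz : z ∈ D.Omega) (k : Fin (m + 1)) :
    D.f z k * D.g z k = 0 := by
  rw [Omega_eq_iUnion_piece] at hz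
  obtain ⟨s, hs⟩ := mem_iUnion.1 hz
  rw [f_of_mem_piece hdisj hs, g_of_mem_piece hdisj hw0 hs]
  obtain rfl | h := eq_or_ne k (row s)
  · rw [Pi.single_eq_of_ne (row_ne_row_swap s), mul_zero]
  · rw [Pi.single_eq_of_ne h, zero_mul]

theorem H_of_mem_piece (hdisj : Pairwise (Disjoint on D.piece))
    (hw0 : ∀ j, ∀ z ∈ D.Omega, D.w j z ≠ 0) (hu : u ∈ D.piece s) (hv : v ∈ D.piece t) :
    D.H u v = (if row s = row t.swap then 1 else 0) *
      (D.c u * D.weight (row s) u * D.pieceA s u *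
        ((D.c v)⁻¹ * (D.weight (row t.swap) v)⁻¹ * D.pieceB t v) / (u - v)) := by
  rw [H_eq_div, f_of_mem_piece hdisj hu, g_of_mem_piece hdisj hw0 hv, single_dotProduct]
  split_ifs with h
  · rw [h, Pi.single_eq_same]
    ring
  · rw [Pi.single_eq_of_ne h]
    ring

theorem H_eq_zero_of_mem_Omega₁ (hdisj : Pairwise (Disjoint on D.piece))
    (hw0 : ∀ j, ∀ z ∈ D.Omega, D.w j z ≠ 0) (hu : u ∈ D.Omega₁) (hv : v ∈ D.Omega₁) :
    D.H u v = 0 := by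
  obtain ⟨i, hi⟩ := mem_iUnion.1 hu
  obtain ⟨j, hj⟩ := mem_iUnion.1 hv
  rw [H_of_mem_piece hdisj hw0 (s := .inl i) (t := .inl j) hi hj, Sum.swap_inl,
    if_neg (row_inl_ne_row_inr i j), zero_mul]

theorem H_eq_zero_of_notMem_Omega₁ (hdisj : Pairwise (Disjoint on D.piece))
    (hw0 : ∀ j, ∀ z ∈ D.Omega, D.w j z ≠ 0) (hu : u ∉ D.Omega₁) (hv : v ∉ D.Omega₁) :
    D.H u v = 0 := by
  by_cases hu' : u ∈ D.Omega
  · by_cases hv' : v ∈ D.Omega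
    · obtain ⟨i, hi⟩ := mem_iUnion.1 (hu'.resolve_left hu)
      obtain ⟨j, hj⟩ := mem_iUnion.1 (hv'.resolve_left hv)
      rw [H_of_mem_piece hdisj hw0 (s := .inr i) (t := .inr j) hi hj, Sum.swap_inr,
        if_neg (row_inl_ne_row_inr j i).symm, zero_mul]
    · rw [H_eq_div, g_eq_zero_of_notMem hv', dotProduct_zero, zero_div]
  · rw [H_eq_div, f_eq_zero_of_notMem hu', zero_dotProduct, zero_div]

theorem disjoint_Omega₁_Omega₂ (hdisj : Pairwise (Disjoint on D.piece)) :
    Disjoint D.Omega₁ D.Omega₂ :=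
  disjoint_iUnion_left.2 fun i => disjoint_iUnion_right.2 fun j =>
    hdisj (i := .inl i) (j := .inr j) Sum.inl_ne_inr

theorem K₁_of_mem (hdisj : Pairwise (Disjoint on D.piece)) {i j : Fin m} (hu : u ∈ D.Ω₁ i)
    (hv : v ∈ D.Ω₂ j) :
    D.K₁ u v = (if row (.inl i) = row (.inl j) then 1 else 0) *
      (D.M i u * D.A i u * D.B j v / (u - v)) := by
  have hdisj_u := hdisj.comp_of_injective Sum.inl_injective
  have hdisj_v := hdisj.comp_of_injective Sum.inr_injective
  rw [K₁, sum_eq_of_mem_of_disjoint hdisj_u hu fun i' hi' => ?_,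
    sum_eq_of_mem_of_disjoint hdisj_v hv fun j' hj' => ?_,
    if_pos ⟨hu, hv⟩, kron_add_kron_add]
  · exact if_neg fun h => hj' h.2
  · exact Finset.sum_eq_zero fun j' _ => if_neg fun h => hi' h.1

theorem K₂_of_mem (hdisj : Pairwise (Disjoint on D.piece)) {i j : Fin m} (hu : u ∈ D.Ω₂ i)
    (hv : v ∈ D.Ω₁ j) :
    D.K₂ u v = (if row (.inr i) = row (.inr j) then 1 else 0) *
      ((D.M i u)⁻¹ * D.A i u * D.B j v / (u - v)) := by
  have hdisj_u := hdisj.comp_of_injective Sum.inr_injective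
  have hdisj_v := hdisj.comp_of_injective Sum.inl_injective
  rw [K₂, sum_eq_of_mem_of_disjoint hdisj_u hu fun i' hi' => ?_,
    sum_eq_of_mem_of_disjoint hdisj_v hv fun j' hj' => ?_,
    if_pos ⟨hu, hv⟩, kron_add_kron_sub]
  · exact if_neg fun h => hj' h.2
  · exact Finset.sum_eq_zero fun j' _ => if_neg fun h => hi' h.1

end Values

/-- The function by which the kernels `K₁` and `K₂` are conjugated into the off-diagonal blocks of
`H`. -/
noncomputable def conjugator (z : ℂ) : ℂ :=
  D.c z * ∑ s, (D.piece s).indicator (D.weight (row s.swap)) z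

section Conjugation

variable {D} {s : Fin m ⊕ Fin m} {u v z : ℂ}

theorem conjugator_of_mem_piece (hdisj : Pairwise (Disjoint on D.piece)) (hz : z ∈ D.piece s) :
    D.conjugator z = D.c z * D.weight (row s.swap) z := by
  rw [conjugator, sum_eq_of_mem_of_disjoint hdisj hz fun t ht => indicator_of_notMem ht _,
    indicator_of_mem hz]

theorem conjugator_ne_zero (hdisj : Pairwise (Disjoint on D.piece))
    (hw0 : ∀ j, ∀ z ∈ D.Omega, D.w j z ≠ 0) (hc0 : ∀ z ∈ D.Omega, D.c z ≠ 0)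
    (hz : z ∈ D.Omega) : D.conjugator z ≠ 0 := by
  obtain ⟨s, hs⟩ := mem_iUnion.1 (D.Omega_eq_iUnion_piece ▸ hz)
  rw [conjugator_of_mem_piece hdisj hs]
  exact mul_ne_zero (hc0 z hz) (weight_ne_zero hw0 _ hz)

theorem H_eq_conjugator_mul_K₁_div (hdisj : Pairwise (Disjoint on D.piece))
    (hw0 : ∀ j, ∀ z ∈ D.Omega, D.w j z ≠ 0) (hu : u ∈ D.Omega₁) (hv : v ∈ D.Omega₂) :
    D.H u v = D.conjugator u * D.K₁ u v / D.conjugator v := by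
  obtain ⟨i, hi⟩ := mem_iUnion.1 hu
  obtain ⟨j, hj⟩ := mem_iUnion.1 hv
  have hweight := weight_ne_zero hw0 (row (.inr i)) (Or.inl hu)
  rw [H_of_mem_piece hdisj hw0 (s := .inl i) (t := .inr j) hi hj, Sum.swap_inr,
    K₁_of_mem hdisj hi hj, conjugator_of_mem_piece hdisj (s := .inl i) hi,
    conjugator_of_mem_piece hdisj (s := .inr j) hj, M_eq_weight_div_weight]
  simp only [Sum.swap_inl, Sum.swap_inr, pieceA, pieceB, Sum.elim_inl, Sum.elim_inr, id,
    Pi.div_apply]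
  field_simp

theorem H_eq_conjugator_mul_K₂_div (hdisj : Pairwise (Disjoint on D.piece))
    (hw0 : ∀ j, ∀ z ∈ D.Omega, D.w j z ≠ 0) (hu : u ∈ D.Omega₂) (hv : v ∈ D.Omega₁) :
    D.H u v = D.conjugator u * D.K₂ u v / D.conjugator v := by
  obtain ⟨i, hi⟩ := mem_iUnion.1 hu
  obtain ⟨j, hj⟩ := mem_iUnion.1 hv
  have hweight := weight_ne_zero hw0 (row (.inl i)) (Or.inr hu)
  rw [H_of_mem_piece hdisj hw0 (s := .inr i) (t := .inl j) hi hj, Sum.swap_inl,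
    K₂_of_mem hdisj hi hj, conjugator_of_mem_piece hdisj (s := .inr i) hi,
    conjugator_of_mem_piece hdisj (s := .inl j) hj, M_eq_weight_div_weight]
  simp only [Sum.swap_inl, Sum.swap_inr, pieceA, pieceB, Sum.elim_inl, Sum.elim_inr, id,
    Pi.div_apply]
  field_simp

end Conjugation

section Measurability

variable {D} {ρ : Measure ℂ}

theorem aemeasurable_weight (hw : ∀ j, AEMeasurable (D.w j) ρ) (k : Fin (m + 1)) :
    AEMeasurable (D.weight k) ρ := by
  by_cases h : (k : ℕ) < m
  · exact D.weight_of_lt h ▸ hw _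
  · exact D.weight_of_eq (k := k) (by omega) ▸ measurable_one.aemeasurable

theorem aemeasurable_f (hS : ∀ s, MeasurableSet (D.piece s)) (hA : ∀ j, AEMeasurable (D.A j) ρ)
    (hw : ∀ j, AEMeasurable (D.w j) ρ) (hc : AEMeasurable D.c ρ) (k : Fin (m + 1)) :
    AEMeasurable (fun z => D.f z k) ρ := by
  simp only [f_apply, F_eq_sum, Finset.sum_apply, Pi.single_apply]
  refine hc.mul ((aemeasurable_weight hw k).mul (Finset.aemeasurable_fun_sum _ fun s _ => ?_))
  split_ifs
  exacts [(hA _).indicator (hS s), aemeasurable_const]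

theorem aemeasurable_g (hS : ∀ s, MeasurableSet (D.piece s)) (hB : ∀ j, AEMeasurable (D.B j) ρ)
    (hw : ∀ j, AEMeasurable (D.w j) ρ) (hc : AEMeasurable D.c ρ)
    (hw0 : ∀ j, ∀ z ∈ D.Omega, D.w j z ≠ 0) (k : Fin (m + 1)) :
    AEMeasurable (fun z => D.g z k) ρ := by
  have hG : AEMeasurable (fun z => D.G z k) ρ := by
    simp only [G_eq_sum, Finset.sum_apply, Pi.single_apply]
    refine Finset.aemeasurable_fun_sum _ fun s _ => ?_
    split_ifs
    exacts [(hB _).indicator (hS s), aemeasurable_const]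
  have hg : (fun z => D.g z k) =
      D.Omega.indicator fun z => (D.c z)⁻¹ * ((D.weight k z)⁻¹ * D.G z k) := by
    ext z
    by_cases hz : z ∈ D.Omega
    · rw [indicator_of_mem hz, g_apply hw0 hz]
    · rw [indicator_of_notMem hz, g_eq_zero_of_notMem hz, Pi.zero_apply]
  rw [hg]
  refine (hc.inv.mul ((aemeasurable_weight hw k).inv.mul hG)).indicator ?_
  rw [Omega_eq_iUnion_piece]
  exact MeasurableSet.iUnion hS

theorem aemeasurable_uncurry_H (hS : ∀ s, MeasurableSet (D.piece s))
    (hA : ∀ j, AEMeasurable (D.A j) ρ) (hB : ∀ j, AEMeasurable (D.B j) ρ)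
    (hw : ∀ j, AEMeasurable (D.w j) ρ) (hc : AEMeasurable D.c ρ)
    (hw0 : ∀ j, ∀ z ∈ D.Omega, D.w j z ≠ 0) :
    AEMeasurable (Function.uncurry D.H) (ρ.prod ρ) := by
  have hH : Function.uncurry D.H =
      fun p : ℂ × ℂ => (∑ k, D.f p.1 k * D.g p.2 k) / (p.1 - p.2) :=
    funext fun p => D.H_eq_div p.1 p.2
  rw [hH]
  refine AEMeasurable.div (Finset.aemeasurable_fun_sum _ fun k _ => ?_)
    (measurable_fst.sub measurable_snd).aemeasurable
  exact ((aemeasurable_f hS hA hw hc k).comp_quasiMeasurePreserving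
      Measure.quasiMeasurePreserving_fst).mul
    ((aemeasurable_g hS hB hw hc hw0 k).comp_quasiMeasurePreserving
      Measure.quasiMeasurePreserving_snd)

end Measurability

end BlockData

/-! ### Conjugation of kernels -/

theorem det_of_mul_div {n 𝕜 : Type*} [Fintype n] [DecidableEq n] [Field 𝕜] (A : Matrix n n 𝕜)
    {p : n → 𝕜} (hp : ∀ i, p i ≠ 0) : (Matrix.of fun i j => p i * A i j / p j).det = A.det := by
  have hrow : (Matrix.of fun i j => p i * A i j / p j) =
      Matrix.of fun i j => p i * Matrix.of (fun i j => (p j)⁻¹ * A i j) i j := by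
    ext i j
    simp only [Matrix.of_apply, div_eq_mul_inv]
    ring
  rw [hrow, Matrix.det_mul_column, Matrix.det_mul_row, ← mul_assoc, ← Finset.prod_mul_distrib,
    Finset.prod_eq_one fun i _ => mul_inv_cancel₀ (hp i), one_mul]

section Conjugation

variable {ρ : Measure ℂ} [SigmaFinite ρ] (τ : ℂ → ℂ) {K K' : ℂ → ℂ → ℂ} {S : Set ℂ}
  (hS : ∀ᵐ u ∂ρ, u ∈ S) {p : ℂ → ℂ} (hp : ∀ u ∈ S, p u ≠ 0)
  (hK : ∀ u ∈ S, ∀ w ∈ S, K' u w = p u * K u w / p w)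
include hS hp hK

theorem fredholmIntegrand_ae_eq_of_conj (n : ℕ) :
    fredholmIntegrand τ K' n =ᵐ[Measure.pi fun _ => ρ] fredholmIntegrand τ K n := by
  have hmem : ∀ᵐ x ∂(Measure.pi fun _ : Fin n => ρ), ∀ i, x i ∈ S :=
    ae_all_iff.2 fun i => (Measure.quasiMeasurePreserving_eval _ i).ae hS
  filter_upwards [hmem] with x hx
  rw [fredholmIntegrand, fredholmIntegrand,
    ← det_of_mul_div (Matrix.of fun i j => K (x i) (x j)) fun i => hp _ (hx i)]
  congr 2
  ext i j
  exact hK _ (hx i) _ (hx j)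

theorem fredholmTerm_eq_of_conj : fredholmTerm ρ τ K' = fredholmTerm ρ τ K :=
  funext fun n =>
    congrArg _ (integral_congr_ae (fredholmIntegrand_ae_eq_of_conj τ hS hp hK n))

theorem fredholmSeries_eq_of_conj : fredholmSeries ρ τ K' = fredholmSeries ρ τ K := by
  rw [fredholmSeries, fredholmTerm_eq_of_conj τ hS hp hK, fredholmSeries]

theorem fredholmSeriesWellDefined_iff_of_conj :
    FredholmSeriesWellDefined ρ τ K' ↔ FredholmSeriesWellDefined ρ τ K := by
  rw [FredholmSeriesWellDefined, FredholmSeriesWellDefined, fredholmTerm_eq_of_conj τ hS hp hK]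
  exact and_congr_left fun _ =>
    forall_congr' fun n => integrable_congr (fredholmIntegrand_ae_eq_of_conj τ hS hp hK n)

end Conjugation

namespace BlockData

open scoped Function

variable {m : ℕ} {D : BlockData m} (hdisj : Pairwise (Disjoint on D.piece))
  (hw0 : ∀ j, ∀ z ∈ D.Omega, D.w j z ≠ 0) (hc0 : ∀ z ∈ D.Omega, D.c z ≠ 0)
  (hS : ∀ s, MeasurableSet (D.piece s))
include hdisj hw0 hc0 hS

theorem compKernel_H_eq_conjugator_mul_div (ρ : Measure ℂ) (τ : ℂ → ℂ) {u w : ℂ}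
    (hu : u ∈ D.Omega₁) (hw : w ∈ D.Omega₁) :
    compKernel (ρ.restrict D.Omega₁ᶜ) τ D.H D.H u w =
      D.conjugator u * compKernel (ρ.restrict D.Omega₂) τ D.K₁ D.K₂ u w / D.conjugator w := by
  have hvanish : ∀ v ∈ D.Omega₁ᶜ \ D.Omega₂, D.H u v * D.H v w * τ v = 0 := by
    intro v ⟨hv₁, hv₂⟩
    rw [H_eq_div, g_eq_zero_of_notMem (not_or_intro hv₁ hv₂), dotProduct_zero]
    simp only [zero_div, zero_mul]
  have hΩ₁ : MeasurableSet D.Omega₁ := .iUnion fun j => hS (.inl j)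
  rw [compKernel, compKernel, setIntegral_eq_of_subset_of_forall_sdiff_eq_zero hΩ₁.compl
    (disjoint_Omega₁_Omega₂ hdisj).subset_compl_left hvanish,
    ← integral_const_mul, ← integral_div]
  refine setIntegral_congr_fun (.iUnion fun j => hS (.inr j)) fun v hv => ?_
  have hpv := conjugator_ne_zero hdisj hw0 hc0 (Or.inr hv)
  simp only [H_eq_conjugator_mul_K₁_div hdisj hw0 hu hv, H_eq_conjugator_mul_K₂_div hdisj hw0 hv hw]
  field_simp

/-- Vanishing of `H` on `Ω₁ × Ω₁` and on `Ω₂ × Ω₂` leaves its two off-diagonal blocks, and these are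
`K₁` and `K₂` up to conjugation. -/
theorem fredholmSeries_K₁_K₂ {ρ : Measure ℂ} [SigmaFinite ρ] {τ : ℂ → ℂ} (hτ : AEMeasurable τ ρ)
    (hA : ∀ j, AEMeasurable (D.A j) ρ) (hB : ∀ j, AEMeasurable (D.B j) ρ)
    (hw : ∀ j, AEMeasurable (D.w j) ρ) (hc : AEMeasurable D.c ρ)
    {T : Lp ℂ 2 ρ →L[ℂ] Lp ℂ 2 ρ} (hT : IsIntegralOperator ρ τ D.H T) (htr : IsTraceClass T) :
    FredholmSeriesWellDefined (ρ.restrict D.Omega₁) τ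
        (compKernel (ρ.restrict D.Omega₂) τ D.K₁ D.K₂) ∧
      HasFredholmDet T
        (fredholmSeries (ρ.restrict D.Omega₁) τ
          (compKernel (ρ.restrict D.Omega₂) τ D.K₁ D.K₂)) := by
  have hΩ₁ : MeasurableSet D.Omega₁ := .iUnion fun j => hS (.inl j)
  have hmem : ∀ᵐ u ∂ρ.restrict D.Omega₁, u ∈ D.Omega₁ := ae_restrict_mem hΩ₁
  have hp : ∀ u ∈ D.Omega₁, D.conjugator u ≠ 0 := fun u hu =>
    conjugator_ne_zero hdisj hw0 hc0 (Or.inl hu)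
  have hconj : ∀ u ∈ D.Omega₁, ∀ w ∈ D.Omega₁, _ := fun u hu w hw =>
    compKernel_H_eq_conjugator_mul_div hdisj hw0 hc0 hS ρ τ hu hw
  rw [← fredholmSeriesWellDefined_iff_of_conj τ hmem hp hconj,
    ← fredholmSeries_eq_of_conj τ hmem hp hconj]
  exact hT.fredholmSeries_offDiagonal htr (aemeasurable_uncurry_H hS hA hB hw hc hw0) hτ hΩ₁
    (fun _ hu _ hv => H_eq_zero_of_mem_Omega₁ hdisj hw0 hu hv)
    (fun _ hu _ hv => H_eq_zero_of_notMem_Omega₁ hdisj hw0 hu hv)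

end BlockData

/-! ### The contour setting and the discrete setting -/

/-- `S` is a countable union of measurable sets of finite `ν`-measure. Unlike σ-finiteness of
`ν.restrict S`, this includes the measurability of `S`, and it passes to countable unions. -/
def IsSigmaFiniteSet {α : Type*} [MeasurableSpace α] (ν : Measure α) (S : Set α) : Prop :=
  ∃ 𝒮 : Set (Set α), 𝒮.Countable ∧ (∀ s ∈ 𝒮, MeasurableSet s ∧ ν s < ∞) ∧ S = ⋃₀ 𝒮

namespace IsSigmaFiniteSet

variable {α ι : Type*} [MeasurableSpace α] {ν : Measure α} {S : Set α}

theorem of_measure_lt_top (hS : MeasurableSet S) (hν : ν S < ∞) : IsSigmaFiniteSet ν S :=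
  ⟨{S}, countable_singleton S, by simp [hS, hν], (sUnion_singleton S).symm⟩

theorem measurableSet (h : IsSigmaFiniteSet ν S) : MeasurableSet S := by
  obtain ⟨𝒮, hc, h𝒮, rfl⟩ := h
  exact MeasurableSet.sUnion hc fun s hs => (h𝒮 s hs).1

theorem iUnion [Countable ι] {S : ι → Set α} (h : ∀ i, IsSigmaFiniteSet ν (S i)) :
    IsSigmaFiniteSet ν (⋃ i, S i) := by
  choose 𝒮 hc h𝒮 hS using h
  refine ⟨⋃ i, 𝒮 i, countable_iUnion hc, fun s hs => ?_, ?_⟩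
  · obtain ⟨i, hi⟩ := mem_iUnion.1 hs
    exact h𝒮 i s hi
  · rw [sUnion_iUnion]
    exact iUnion_congr hS

theorem sigmaFinite_restrict (h : IsSigmaFiniteSet ν S) : SigmaFinite (ν.restrict S) := by
  have hm := h.measurableSet
  obtain ⟨𝒮, hc, h𝒮, hS⟩ := h
  refine Measure.sigmaFinite_of_countable (hc.insert Sᶜ) ?_ ?_
  · rintro s (rfl | hs)
    · rw [Measure.restrict_apply hm.compl, compl_inter_self, measure_empty]
      exact ENNReal.zero_lt_top
    · exact (Measure.restrict_apply_le _ _).trans_lt (h𝒮 s hs).2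
  · rw [sUnion_insert, ← hS, compl_union_self]

end IsSigmaFiniteSet

theorem isSigmaFiniteSet_count_of_countable {α : Type*} [MeasurableSpace α]
    [MeasurableSingletonClass α] {S : Set α} (hS : S.Countable) :
    IsSigmaFiniteSet Measure.count S := by
  have := hS.to_subtype
  rw [← iUnion_of_singleton_coe S]
  exact .iUnion fun x => .of_measure_lt_top (measurableSet_singleton _) (by simp)

theorem exists_iUnion_Icc_eq_of_ordConnected {α : Type*} [TopologicalSpace α] [LinearOrder α]
    [OrderTopology α] [SecondCountableTopology α] {J : Set α} (hJ : J.OrdConnected) :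
    ∃ s : Set (J × J), s.Countable ∧ J = ⋃ p ∈ s, Icc (p.1 : α) p.2 := by
  obtain rfl | hne := J.eq_empty_or_nonempty
  · exact ⟨∅, countable_empty, by simp⟩
  have := hne.to_subtype
  obtain ⟨l, -, hl⟩ := exists_seq_antitone_tendsto_atTop_atBot J
  obtain ⟨r, -, hr⟩ := exists_seq_monotone_tendsto_atTop_atTop J
  refine ⟨range l ×ˢ range r, (countable_range l).prod (countable_range r),
    subset_antisymm (fun x hx => ?_) (iUnion₂_subset fun p _ => hJ.out p.1.2 p.2.2)⟩
  obtain ⟨i, hi⟩ := (hl.eventually_le_atBot ⟨x, hx⟩).exists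
  obtain ⟨j, hj⟩ := (hr.eventually_ge_atTop ⟨x, hx⟩).exists
  exact mem_iUnion₂.2 ⟨(l i, r j), ⟨mem_range_self i, mem_range_self j⟩, hi, hj⟩

section Curves

variable {E : Type*} [NormedAddCommGroup E] [NormedSpace ℝ E] [MeasurableSpace E] [BorelSpace E]
  {γ : ℝ → E}

theorem hausdorffMeasure_image_Icc_lt_top {a b : ℝ} (hγ : ContDiffOn ℝ 1 γ (Icc a b)) :
    Measure.hausdorffMeasure 1 (γ '' Icc a b) < ∞ := by
  obtain ⟨C, hC⟩ := hγ.exists_lipschitzOnWith one_ne_zero (convex_Icc a b) isCompact_Icc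
  refine (hC.hausdorffMeasure_image_le zero_le_one).trans_lt ?_
  rw [hausdorffMeasure_real, ENNReal.rpow_one]
  exact ENNReal.mul_lt_top ENNReal.coe_lt_top isCompact_Icc.measure_lt_top

theorem isSigmaFiniteSet_hausdorffMeasure_image {J : Set ℝ} (hJ : J.OrdConnected)
    (hγ : ContDiffOn ℝ 1 γ J) : IsSigmaFiniteSet (Measure.hausdorffMeasure 1) (γ '' J) := by
  obtain ⟨s, hs, hJs⟩ := exists_iUnion_Icc_eq_of_ordConnected hJ
  have := hs.to_subtype
  rw [hJs, biUnion_eq_iUnion, image_iUnion]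
  refine .iUnion fun p => ?_
  have hγp := hγ.mono (hJ.out p.1.1.2 p.1.2.2)
  exact .of_measure_lt_top
    (isCompact_Icc.image_of_continuousOn hγp.continuousOn).isClosed.measurableSet
    (hausdorffMeasure_image_Icc_lt_top hγp)

end Curves

theorem IsContourUnion.isSigmaFiniteSet {τ : ℂ → ℂ} {S : Set ℂ} (h : IsContourUnion τ S) :
    IsSigmaFiniteSet (Measure.hausdorffMeasure 1) S := by
  obtain ⟨n, J, γ, hJ, rfl⟩ := h
  exact .iUnion fun i => isSigmaFiniteSet_hausdorffMeasure_image (hJ i).1 (hJ i).2.1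

namespace BlockData

variable {m : ℕ} {D : BlockData m} {ρ : Measure ℂ} {τ : ℂ → ℂ}

theorem exists_isSigmaFiniteSet_piece_of_setting
    (h : D.IsDiscreteSetting ρ τ ∨ D.IsContourSetting ρ τ) :
    ∃ ν : Measure ℂ, ρ = ν.restrict D.Omega ∧ ∀ s, IsSigmaFiniteSet ν (D.piece s) := by
  rcases h with ⟨h₁, h₂, hρ, -⟩ | ⟨-, -, h₁, h₂, hρ⟩
  · have hcount {S : Set ℂ} (hS : IsDiscrete S) : IsSigmaFiniteSet Measure.count S :=
      isSigmaFiniteSet_count_of_countable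
        ((HereditarilyLindelofSpace.isLindelof S).countable_of_isDiscrete hS)
    exact ⟨_, hρ, Sum.rec (fun j => hcount (h₁ j)) fun j => hcount (h₂ j)⟩
  · exact ⟨_, hρ, Sum.rec (fun j => (h₁ j).isSigmaFiniteSet) fun j => (h₂ j).isSigmaFiniteSet⟩

theorem measurableSet_piece_of_setting
    (h : D.IsDiscreteSetting ρ τ ∨ D.IsContourSetting ρ τ) (s : Fin m ⊕ Fin m) :
    MeasurableSet (D.piece s) :=
  have ⟨_, _, hν⟩ := exists_isSigmaFiniteSet_piece_of_setting h
  (hν s).measurableSet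

theorem sigmaFinite_of_setting (h : D.IsDiscreteSetting ρ τ ∨ D.IsContourSetting ρ τ) :
    SigmaFinite ρ := by
  obtain ⟨ν, rfl, hν⟩ := exists_isSigmaFiniteSet_piece_of_setting h
  rw [Omega_eq_iUnion_piece]
  exact (IsSigmaFiniteSet.iUnion hν).sigmaFinite_restrict

theorem measurable_of_setting (h : D.IsDiscreteSetting ρ τ ∨ D.IsContourSetting ρ τ) :
    Measurable τ := by
  rcases h with ⟨-, -, -, rfl⟩ | ⟨hτ, -⟩
  exacts [measurable_const, hτ]

end BlockData

theorem mainTheorem4_general {m : ℕ} {D : BlockData m} {ρ : Measure ℂ} [SigmaFinite ρ]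
    {τ : ℂ → ℂ} (hdisj : Pairwise (Function.onFun Disjoint D.piece))
    (hmeas : ∀ s, MeasurableSet (D.piece s)) (hτ : AEMeasurable τ ρ)
    (hA : ∀ j, AEMeasurable (D.A j) ρ) (hB : ∀ j, AEMeasurable (D.B j) ρ)
    (hw : ∀ j, AEMeasurable (D.w j) ρ) (hc : AEMeasurable D.c ρ)
    (hw0 : ∀ j, ∀ z ∈ D.Omega, D.w j z ≠ 0) (hc0 : ∀ z ∈ D.Omega, D.c z ≠ 0) :
    (∀ T : Lp ℂ 2 ρ →L[ℂ] Lp ℂ 2 ρ, IsIntegralOperator ρ τ D.H T → IsTraceClass T →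
      FredholmSeriesWellDefined (ρ.restrict D.Omega₁) τ
        (compKernel (ρ.restrict D.Omega₂) τ D.K₁ D.K₂) ∧
      HasFredholmDet T
        (fredholmSeries (ρ.restrict D.Omega₁) τ
          (compKernel (ρ.restrict D.Omega₂) τ D.K₁ D.K₂))) ∧
    ∀ z ∈ D.Omega, ∀ i, D.f z i * D.g z i = 0 :=
  ⟨fun _ hT htr => BlockData.fredholmSeries_K₁_K₂ hdisj hw0 hc0 hmeas hτ hA hB hw hc hT htr,
    fun _ hz i => BlockData.f_mul_g_eq_zero hdisj hw0 hz i⟩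

theorem mainTheorem4 (m : ℕ) (hm : 1 ≤ m) (D : BlockData m)
    (ρ : Measure ℂ) (τ : ℂ → ℂ)
    (hdisj : Pairwise (Function.onFun Disjoint (Sum.elim D.Ω₁ D.Ω₂)))
    (hset : D.IsDiscreteSetting ρ τ ∨ D.IsContourSetting ρ τ)
    (hA : ∀ j, AEMeasurable (D.A j) ρ) (hB : ∀ j, AEMeasurable (D.B j) ρ)
    (hw : ∀ j, AEMeasurable (D.w j) ρ) (hc : AEMeasurable D.c ρ)
    (hw0 : ∀ j, ∀ z ∈ D.Omega, D.w j z ≠ 0) (hc0 : ∀ z ∈ D.Omega, D.c z ≠ 0) :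
    (∀ T : Lp ℂ 2 ρ →L[ℂ] Lp ℂ 2 ρ, IsIntegralOperator ρ τ D.H T → IsTraceClass T →
      FredholmSeriesWellDefined (ρ.restrict D.Omega₁) τ
        (compKernel (ρ.restrict D.Omega₂) τ D.K₁ D.K₂) →
      HasFredholmDet T
        (fredholmSeries (ρ.restrict D.Omega₁) τ
          (compKernel (ρ.restrict D.Omega₂) τ D.K₁ D.K₂))) ∧
    ∀ z ∈ D.Omega, ∀ i, D.f z i * D.g z i = 0 := by
  have := BlockData.sigmaFinite_of_setting hset
  have hmeas := BlockData.measurableSet_piece_of_setting hset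
  have ⟨hdet, hfg⟩ := mainTheorem4_general hdisj hmeas
    (BlockData.measurable_of_setting hset).aemeasurable hA hB hw hc hw0 hc0
  exact ⟨fun T hT htr _ => (hdet T hT htr).2, hfg⟩
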